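/- Let $\mathcal R$ be the oriented (Reeb) foliation of $\mathbb R^2$ whose leaves are the horizontal lines $\{(t,v):t\in\mathbb R\}$ for $|v|\ge 1$ and the curves $\{(u-1/\cos(\tfrac{\pi}{2}t),\,t):-1<t<1\}$ for $u\in\mathbb R$, where the lines with $v\le -1$ are oriented to the right, the lines with $v\ge 1$ are oriented to the left, and the curves are oriented by increasing $t$. Write $L(x)$ for the leaf through $x$, and let $\Delta=\{y=-1\}$ and $\Delta'=\{y=1\}$ be the nonseparated leaves. An $\mathcal R$-homeomorphism is an orientation preserving, fixed point free homeomorphism $f$ of $\mathbb R^2$ such that, for each leaf $L$, $f(L)=L$ and each $x\in L$ occurs before $f(x)$ on $L$. A flow $(\Phi^t)_{t\in\mathbb R}$ on $\mathbb R^2$ (a continuous action of $(\mathbb R,+)$ by homeomorphisms) is an $\mathcal R$-flow if $\Phi^t$ is an $\mathcal R$-homeomorphism for each $t>0$. An $\mathcal R$-homeomorphism $f$ has the four point matching property if, for all $(x,x')\in\Delta\times\Delta'$ and all sequences $(x_k),(y_k)$ in $\mathbb R^2$ with $x_k\to x$, $f^k(x_k)\to x'$ and $y_k\in L(x_k)$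 for all $k$, the sequence $(y_k)$ converges to a point of $\Delta$ if and only if the sequence $(f^k(y_k))$ converges to a point of $\Delta'$. For $(x,x'),(y,y')\in\Delta\times\Delta'$ write $(x,x')\sim_f(y,y')$ if there are sequences $(x_k),(y_k)$ in $\mathbb R^2$ with $y_k\in L(x_k)$ for all $k$, $x_k\to x$, $y_k\to y$, $f^k(x_k)\to x'$ and $f^k(y_k)\to y'$. An $f$ with the four point matching property has the eight point matching property if, for all $x_1,y_1,x_2,y_2\in\Delta$ and $x_1',y_1',x_2',y_2'\in\Delta'$, any three of the four relations $$(x_1,x_1')\sim_f(y_1,y_1'),\quad (x_1,x_2')\sim_f(y_1,y_2'),\quad (x_2,x_1')\sim_f(y_2,y_1'),\quad (x_2,x_2')\sim_f(y_2,y_2')$$ imply the remaining one. Theorem. Let $f$ be an $\mathcal R$-homeomorphism. Then there is an $\mathcal R$-flow $(\Phi^t)$ with $\Phi^1=f$ if and only if $f$ has both the four point and the eight point matching properties. Furthermore, if $(\Phi^t)$ and $(\Psi^t)$ are two $\mathcal R$-flows with $\Phi^1=\Psi^1=f$, then $\Phi^t(x)=\Psi^t(x)$ for every real number $t$ and every $x\in\Delta\cup\Delta'$.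 -/

import Mathlib

open Filter Topology

namespace Reeb

/-- The plane, with its usual topology. -/
abbrev Plane : Type := ℝ × ℝ

/-- The punctured plane. -/
abbrev Punctured : Type := {v : Plane // v ≠ 0}

/-- The map `v ↦ f (p + v) - f p` of the punctured plane to itself, for a homeomorphism `f`. -/
def centredAt (f : Plane ≃ₜ Plane) (p : Plane) : C(Punctured, Punctured) where
  toFun v := ⟨f (p + v.1) - f p, fun h => v.2 (by
    have h1 : p + v.1 = p := f.injective (sub_eq_zero.1 h)
    simpa using h1)⟩
  continuous_toFun := by
    refine Continuous.subtype_mk ?_ _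
    exact (f.continuous.comp (continuous_const.add continuous_subtype_val)).sub continuous_const

/-- A homeomorphism of the plane preserves orientation if it has local degree `+1` at every point:
after moving `p` and `f p` to the origin, it is homotopic to the identity as a map of the
punctured plane to itself. (Self-maps of the punctured plane are classified up to homotopy by
their degree.) -/
def OrientationPreserving (f : Plane ≃ₜ Plane) : Prop :=
  ∀ p : Plane, (centredAt f p).Homotopic (ContinuousMap.id Punctured)

/-- A Brouwer homeomorphism: orientation preserving, without fixed points. -/
def IsBrouwerHomeo (f : Plane ≃ₜ Plane) : Prop :=
  OrientationPreserving f ∧ ∀ p, f p ≠ p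

/-- The horizontal line at height `v`. -/
def lineLeaf (v : ℝ) : Set Plane := {p | ∃ t : ℝ, p = (t, v)}

/-- The curve `t ↦ (u - 1 / cos (π t / 2), t)`, `-1 < t < 1`. -/
def curveLeaf (u : ℝ) : Set Plane :=
  {p | ∃ t : ℝ, -1 < t ∧ t < 1 ∧ p = (u - (Real.cos (Real.pi / 2 * t))⁻¹, t)}

/-- The set of leaves of the Reeb foliation. -/
def leaves : Set (Set Plane) :=
  {L | (∃ v : ℝ, 1 ≤ |v| ∧ L = lineLeaf v) ∨ ∃ u : ℝ, L = curveLeaf u}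

/-- The leaf through `x`, as the set of all points that lie on a common leaf with `x`. -/
def leafOf (x : Plane) : Set Plane := {y | ∃ L ∈ leaves, x ∈ L ∧ y ∈ L}

/-- The nonseparated leaf `y = -1`. -/
def Delta : Set Plane := lineLeaf (-1)

/-- The nonseparated leaf `y = 1`. -/
def Delta' : Set Plane := lineLeaf 1

/-- `Before p q`: the points `p` and `q` lie on the same leaf, and `p` occurs before `q` in the
orientation of that leaf. The lines `y = v` are oriented to the right for `v ≤ -1` and to the left
for `v ≥ 1`; compatibly with both, the curves in between are oriented by increasing height. -/
def Before (p q : Plane) : Prop :=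
  (∃ v : ℝ, v ≤ -1 ∧ p ∈ lineLeaf v ∧ q ∈ lineLeaf v ∧ p.1 < q.1) ∨
  (∃ v : ℝ, 1 ≤ v ∧ p ∈ lineLeaf v ∧ q ∈ lineLeaf v ∧ q.1 < p.1) ∨
  (∃ u : ℝ, p ∈ curveLeaf u ∧ q ∈ curveLeaf u ∧ p.2 < q.2)

/-- A homeomorphism of the Reeb foliation: a Brouwer homeomorphism that maps each leaf onto
itself and moves every point forward on its leaf. -/
def IsReebHomeo (f : Plane ≃ₜ Plane) : Prop :=
  IsBrouwerHomeo f ∧ ∀ L ∈ leaves, f '' L = L ∧ ∀ x ∈ L, Before x (f x)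

/-- A flow of the Reeb foliation: each map of positive time is a homeomorphism of the
Reeb foliation. -/
def IsReebFlow (Φ : Flow ℝ Plane) : Prop :=
  ∀ t : ℝ, 0 < t → IsReebHomeo (Φ.toHomeomorph t)

/-- `f` is the time one map of the flow `Φ`. -/
def IsTimeOne (Φ : Flow ℝ Plane) (f : Plane ≃ₜ Plane) : Prop := ∀ x, Φ 1 x = f x

/-- `f` is the time one map of some flow of the Reeb foliation. -/
def Flowable (f : Plane ≃ₜ Plane) : Prop :=
  ∃ Φ : Flow ℝ Plane, IsReebFlow Φ ∧ IsTimeOne Φ f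

/-- The four point matching property. -/
def FourPoint (f : Plane ≃ₜ Plane) : Prop :=
  ∀ x ∈ Delta, ∀ x' ∈ Delta', ∀ a b : ℕ → Plane,
    Tendsto a atTop (𝓝 x) →
    Tendsto (fun k => f^[k] (a k)) atTop (𝓝 x') →
    (∀ k, b k ∈ leafOf (a k)) →
    ((∃ y ∈ Delta, Tendsto b atTop (𝓝 y)) ↔
      ∃ y' ∈ Delta', Tendsto (fun k => f^[k] (b k)) atTop (𝓝 y'))

/-- The relation `(x, x') ∼_f (y, y')` on `Δ × Δ'`. -/
def Sim (f : Plane ≃ₜ Plane) (p q : Delta × Delta') : Prop :=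
  ∃ a b : ℕ → Plane,
    (∀ k, b k ∈ leafOf (a k)) ∧
    Tendsto a atTop (𝓝 (p.1 : Plane)) ∧
    Tendsto b atTop (𝓝 (q.1 : Plane)) ∧
    Tendsto (fun k => f^[k] (a k)) atTop (𝓝 (p.2 : Plane)) ∧
    Tendsto (fun k => f^[k] (b k)) atTop (𝓝 (q.2 : Plane))

/-- The matching condition of the eight point matching property; that property is only considered
for `f` with the four point matching property. Each three of the four relations imply the
remaining one. -/
def EightPoint (f : Plane ≃ₜ Plane) : Prop :=
  ∀ (x₁ y₁ x₂ y₂ : Delta) (x₁' y₁' x₂' y₂' : Delta'),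
    let A := Sim f (x₁, x₁') (y₁, y₁')
    let B := Sim f (x₁, x₂') (y₁, y₂')
    let C := Sim f (x₂, x₁') (y₂, y₁')
    let D := Sim f (x₂, x₂') (y₂, y₂')
    (B ∧ C ∧ D → A) ∧ (A ∧ C ∧ D → B) ∧ (A ∧ B ∧ D → C) ∧ (A ∧ B ∧ C → D)

end Reeb

/-! An `f` that embeds in a flow is one with a good clock: on each leaf a time function, increasing
onto ℝ, gaining 1 under `f` and varying continuously with the leaf. Two foliated charts, one around
each nonseparated leaf, cover the plane and overlap exactly in the curved leaves. A flow with time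
one map `f` is the same as a pair of continuous time functions T, T', one per chart, that differ by
a constant on each curve (`IsReebFlow.exists_isTime`, `flowable_of_time`).

Given such a pair, passing from a point near Δ to its k-th iterate near Δ' changes the clock reading
by an amount that depends only on k and the leaf. Hence (x,x') ∼ (y,y') means T(y) - T(x) = T'(y') -
T'(x'), and both matching properties become arithmetic (`chartFourPoint_of_time`,
`chartSim_iff_of_time`).

Conversely, the four point property makes ∼ an equivalence relation on Δ × Δ' whose classes are
graphs of increasing bijections Δ → Δ' (`IsReebModel.isMatching`). Identify the two lines by one of
these bijections. The others become increasing bijections of a single line, exactly one carrying the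
base point to any given point, and the eight point property says that they compose. The line thus
becomes an ordered group; being complete and dense, it is (ℝ,+) by Hölder's theorem
(`exists_orderIso_real_of_complete`). This yields coordinates on Δ and Δ' in which ∼ is equality of
differences and, after scaling, `f` is translation by 1 (`exists_orderIso_normalized`). The
coordinate on Δ' extends to a time function over the whole upper chart
(`IsPushFamily.exists_isTime`); carried along the curves it stays continuous at Δ, by the four point
property (`IsReebModel.exists_time`).

For uniqueness on Δ ∪ Δ', the relation ∼ depends only on `f` and determines the time functions there
up to a continuous additive map of ℝ, which is linear; the unit step of `f` fixes the slope
(`sub_eq_sub_of_matching`). -/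

namespace Reeb

open Function

/-! ### Hölder's theorem for complete ordered groups -/

section OrderedGroup

variable {X : Type*} [AddGroup X] [ConditionallyCompleteLinearOrder X]
  [AddLeftMono X] [AddRightMono X]

/-- If the multiples of x were bounded, some multiple would exceed their supremum minus x, and the
next one would exceed the supremum. -/
theorem exists_lt_nsmul_of_complete {x : X} (hx : 0 < x) (y : X) : ∃ n : ℕ, y < n • x := by
  by_contra! h
  have hb : BddAbove (Set.range fun n : ℕ => n • x) := ⟨y, by rintro _ ⟨n, rfl⟩; exact h n⟩
  have hlt : sSup (Set.range fun n : ℕ => n • x) + -x < sSup (Set.range fun n : ℕ => n • x) := by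
    have := add_lt_add_right (neg_lt_zero.2 hx) (sSup (Set.range fun n : ℕ => n • x))
    simpa using this
  obtain ⟨_, ⟨n, rfl⟩, hn⟩ := exists_lt_of_lt_csSup (Set.range_nonempty _) hlt
  have h1 : (n + 1) • x ≤ sSup (Set.range fun n : ℕ => n • x) := le_csSup hb ⟨n + 1, rfl⟩
  rw [succ_nsmul] at h1
  have h2 : n • x ≤ sSup (Set.range fun n : ℕ => n • x) + -x := by
    rw [← sub_eq_add_neg]; exact le_sub_iff_add_le.2 h1
  exact absurd hn (not_lt.2 h2)

theorem exists_nsmul_le_lt_of_complete {d a : X} (hd : 0 < d) (ha : 0 ≤ a) :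
    ∃ n : ℕ, n • d ≤ a ∧ a < (n + 1) • d := by
  classical
  have hex := exists_lt_nsmul_of_complete hd a
  have hne : Nat.find hex ≠ 0 := by
    intro h0
    have := Nat.find_spec hex
    rw [h0, zero_nsmul] at this
    exact absurd this (not_lt.2 ha)
  obtain ⟨n, hn⟩ := Nat.exists_eq_succ_of_ne_zero hne
  refine ⟨n, not_lt.1 (Nat.find_min hex (by omega)), ?_⟩
  have := Nat.find_spec hex
  rwa [hn] at this

variable [DenselyOrdered X]

theorem exists_pos_add_self_le {ε : X} (hε : 0 < ε) : ∃ d : X, 0 < d ∧ d + d ≤ ε := by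
  obtain ⟨η, h0, h1⟩ := exists_between hε
  have h2 : 0 < -η + ε := by
    have := add_lt_add_right h1 (-η)
    simpa using this
  -- The group is not yet known to be commutative: ε is cut into η followed by -η + ε, and the
  -- smaller piece is taken.
  refine ⟨min η (-η + ε), lt_min h0 h2, ?_⟩
  calc min η (-η + ε) + min η (-η + ε) ≤ η + (-η + ε) :=
        add_le_add (min_le_left _ _) (min_le_right _ _)
    _ = ε := by simp

theorem add_le_add_comm_of_complete {a b : X} (ha : 0 ≤ a) (hb : 0 ≤ b) : a + b ≤ b + a := by
  by_contra! h
  have hε : 0 < -(b + a) + (a + b) := by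
    have := add_lt_add_right h (-(b + a))
    simpa using this
  obtain ⟨d, hd, hdd⟩ := exists_pos_add_self_le hε
  obtain ⟨n, hn1, hn2⟩ := exists_nsmul_le_lt_of_complete hd ha
  obtain ⟨m, hm1, hm2⟩ := exists_nsmul_le_lt_of_complete hd hb
  have h1 : a + b < (n + 1) • d + (m + 1) • d := add_lt_add hn2 hm2
  have h2 : (n + 1) • d + (m + 1) • d = m • d + n • d + (d + d) := by
    rw [← two_nsmul, ← add_nsmul, ← add_nsmul, ← add_nsmul]; congr 1; omega
  have h3 : m • d + n • d + (d + d) ≤ b + a + (-(b + a) + (a + b)) :=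
    add_le_add (add_le_add hm1 hn1) hdd
  rw [h2] at h1
  have h4 := h1.trans_le h3
  rw [add_neg_cancel_left] at h4
  exact lt_irrefl _ h4

theorem add_comm_of_complete (a b : X) : a + b = b + a := by
  have key : ∀ a b : X, 0 ≤ a → 0 ≤ b → AddCommute a b := fun a b ha hb =>
    le_antisymm (add_le_add_comm_of_complete ha hb) (add_le_add_comm_of_complete hb ha)
  have key2 : ∀ a b : X, 0 ≤ a → AddCommute a b := by
    intro a b ha
    rcases le_total 0 b with hb | hb
    · exact key a b ha hb
    · have := key a (-b) ha (by simpa using hb)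
      simpa using this.neg_right
  rcases le_total 0 a with ha | ha
  · exact key2 a b ha
  · have := key2 (-a) b (by simpa using ha)
    have h := this.neg_left
    rw [neg_neg] at h
    exact h

/-- The group is commutative and Archimedean, hence embeds in ℝ. Repeated halving makes the image
dense, and suprema fill in the remaining reals. -/
theorem exists_orderIso_real_of_complete [Nontrivial X] :
    ∃ φ : X ≃o ℝ, ∀ x y, φ (x + y) = φ x + φ y := by
  let _ : AddCommGroup X := { ‹AddGroup X› with add_comm := add_comm_of_complete }
  have : IsOrderedAddMonoid X :=
    ⟨fun a b h c => by gcongr, fun a b h c => by gcongr⟩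
  have : Archimedean X := ⟨fun x y hy => (exists_lt_nsmul_of_complete hy x).imp fun n h => h.le⟩
  obtain ⟨φ, hφ⟩ := Archimedean.exists_orderAddMonoidHom_real_injective X
  have hmono : StrictMono φ := φ.monotone'.strictMono_of_injective hφ
  have hdense : Dense (((φ : X →+ ℝ).range : AddSubgroup ℝ) : Set ℝ) := by
    apply AddSubgroup.dense_of_not_isolated_zero
    intro ε hε
    obtain ⟨z, hz⟩ : ∃ z : X, 0 < z := exists_gt 0
    have hzφ : 0 < φ z := by simpa using hmono hz
    have key : ∀ n : ℕ, ∃ d : X, 0 < d ∧ (2 : ℝ) ^ n * φ d ≤ φ z := by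
      intro n
      induction n with
      | zero => exact ⟨z, hz, by simp⟩
      | succ n ih =>
        obtain ⟨d, hd, hle⟩ := ih
        obtain ⟨d', hd', hle'⟩ := exists_pos_add_self_le hd
        refine ⟨d', hd', ?_⟩
        have h1 : φ d' + φ d' ≤ φ d := by rw [← map_add]; exact φ.monotone' hle'
        have h2 : (0 : ℝ) < 2 ^ n := by positivity
        rw [pow_succ]
        nlinarith
    obtain ⟨n, hn⟩ := pow_unbounded_of_one_lt (φ z / ε) (one_lt_two)
    obtain ⟨d, hd, hle⟩ := key n
    refine ⟨φ d, ⟨d, rfl⟩, by simpa using hmono hd, ?_⟩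
    rw [div_lt_iff₀ hε] at hn
    exact lt_of_mul_lt_mul_left (hle.trans_lt hn) (by positivity)
  have hsurj : Surjective φ := by
    intro y
    have hne : {x | φ x ≤ y}.Nonempty := by
      obtain ⟨_, ⟨x, rfl⟩, h⟩ := hdense.exists_between (sub_one_lt y)
      exact ⟨x, h.2.le⟩
    have hbd : BddAbove {x | φ x ≤ y} := by
      obtain ⟨_, ⟨x, rfl⟩, h⟩ := hdense.exists_between (lt_add_one y)
      exact ⟨x, fun z hz => hmono.le_iff_le.1 (le_trans hz h.1.le)⟩
    refine ⟨sSup {x | φ x ≤ y}, le_antisymm ?_ ?_⟩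
    · by_contra! h
      obtain ⟨_, ⟨x, rfl⟩, h⟩ := hdense.exists_between h
      have : sSup {x | φ x ≤ y} ≤ x :=
        csSup_le hne fun z hz => hmono.le_iff_le.1 (le_trans hz h.1.le)
      exact absurd h.2 (not_lt.2 (φ.monotone' this))
    · by_contra! h
      obtain ⟨_, ⟨x, rfl⟩, h⟩ := hdense.exists_between h
      have : x ≤ sSup {x | φ x ≤ y} := le_csSup hbd h.2.le
      exact absurd h.1 (not_lt.2 (φ.monotone' this))
  exact ⟨hmono.orderIsoOfSurjective φ hsurj, fun x y => map_add φ x y⟩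

end OrderedGroup

/-! ### Continuous families of increasing homeomorphisms of the line -/

section Families

variable {S : Type*} [TopologicalSpace S]

/-- By monotonicity a < G s y means F s a < y, which is an open condition on (s, y); likewise from
above. -/
theorem continuous_uncurry_of_rightInverse {F G : S → ℝ → ℝ} (hF : Continuous (uncurry F))
    (hm : ∀ s, StrictMono (F s)) (h : ∀ s y, F s (G s y) = y) : Continuous (uncurry G) := by
  rw [continuous_iff_continuousAt]
  rintro ⟨s, y⟩
  refine tendsto_order.2 ⟨fun a ha => ?_, fun a ha => ?_⟩
  · have h1 : F s a < y := by simpa [h] using hm s ha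
    have h2 : ∀ᶠ p : S × ℝ in 𝓝 (s, y), F p.1 a < p.2 :=
      ((hF.comp (continuous_fst.prodMk continuous_const)).continuousAt).eventually_lt
        continuous_snd.continuousAt h1
    filter_upwards [h2] with p hp
    rwa [← h p.1 p.2, (hm p.1).lt_iff_lt] at hp
  · have h1 : y < F s a := by simpa [h] using hm s ha
    have h2 : ∀ᶠ p : S × ℝ in 𝓝 (s, y), p.2 < F p.1 a :=
      continuous_snd.continuousAt.eventually_lt
        ((hF.comp (continuous_fst.prodMk continuous_const)).continuousAt) h1
    filter_upwards [h2] with p hp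
    rwa [← h p.1 p.2, (hm p.1).lt_iff_lt] at hp

theorem continuous_uncurry_iterate {F : S → ℝ → ℝ} (hF : Continuous (uncurry F)) (n : ℕ) :
    Continuous fun p : S × ℝ => (F p.1)^[n] p.2 := by
  induction n with
  | zero => exact continuous_snd
  | succ n ih =>
    simp only [iterate_succ_apply']
    exact hF.comp (continuous_fst.prodMk ih)

/-- A bounded increasing orbit would converge to a fixed point. -/
theorem exists_lt_iterate {g : ℝ → ℝ} (hg : Continuous g) (h : ∀ x, x < g x) (x M : ℝ) :
    ∃ n : ℕ, M < g^[n] x := by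
  by_contra! hb
  have hmono : Monotone fun n => g^[n] x :=
    monotone_nat_of_le_succ fun n => by rw [iterate_succ_apply']; exact (h _).le
  have := tendsto_atTop_ciSup hmono ⟨M, by rintro _ ⟨n, rfl⟩; exact hb n⟩
  have hfix := isFixedPt_of_tendsto_iterate this hg.continuousAt
  exact absurd (h _) (by rw [hfix]; exact lt_irrefl _)

/-- A continuous family of increasing homeomorphisms of the line, moving every point forward. -/
structure IsPushFamily (A : S → ℝ → ℝ) : Prop where
  cont : Continuous (uncurry A)
  mono : ∀ s, StrictMono (A s)
  surj : ∀ s, Surjective (A s)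
  lt : ∀ s x, x < A s x

/-- A continuous family of increasing homeomorphisms of the line, conjugating each member of the
family `A` to the unit translation. -/
structure IsTime (T A : S → ℝ → ℝ) : Prop where
  cont : Continuous (uncurry T)
  mono : ∀ s, StrictMono (T s)
  surj : ∀ s, Surjective (T s)
  step : ∀ s x, T s (A s x) = T s x + 1

theorem IsTime.iterate {T A : S → ℝ → ℝ} (h : IsTime T A) (s : S) (n : ℕ) (x : ℝ) :
    T s ((A s)^[n] x) = T s x + n := by
  induction n with
  | zero => simp
  | succ n ih => rw [iterate_succ_apply', h.step, ih]; push_cast; ring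

theorem IsPushFamily.cont_apply {A : S → ℝ → ℝ} (h : IsPushFamily A) (s : S) :
    Continuous (A s) := h.cont.comp (continuous_const.prodMk continuous_id)

/-- The interval [0, A s 0) is a fundamental domain, so an invariant property need only be checked
there. -/
theorem IsPushFamily.induction {A : S → ℝ → ℝ} (h : IsPushFamily A) (s : S) {P : ℝ → Prop}
    (h0 : ∀ x, 0 ≤ x → x < A s 0 → P x) (h1 : ∀ x, P x ↔ P (A s x)) (x : ℝ) : P x := by
  have key : ∀ n : ℕ, ∀ x, 0 ≤ x → x < (A s)^[n] 0 → P x := by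
    intro n
    induction n with
    | zero => intro x hx hx'; exact absurd hx' (not_lt.2 hx)
    | succ n ih =>
      intro x hx hx'
      rcases lt_or_ge x (A s 0) with hlt | hge
      · exact h0 x hx hlt
      · obtain ⟨x', rfl⟩ := h.surj s x
        rw [iterate_succ_apply', (h.mono s).lt_iff_lt] at hx'
        exact (h1 x').1 (ih x' ((h.mono s).le_iff_le.1 hge) hx')
  have hpos : ∀ x, 0 ≤ x → P x := fun x hx => by
    obtain ⟨n, hn⟩ := exists_lt_iterate (h.cont_apply s) (h.lt s) 0 x
    exact key n x hx hn
  obtain ⟨n, hn⟩ := exists_lt_iterate (h.cont_apply s) (h.lt s) x 0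
  have hi : ∀ n : ℕ, P ((A s)^[n] x) → P x := by
    intro n
    induction n with
    | zero => exact id
    | succ n ih => rw [iterate_succ_apply']; exact fun hp => ih ((h1 _).2 hp)
  exact hi n (hpos _ hn.le)

end Families

/-! ### Extending a time function from one parameter to all -/

section TimeExtension

variable {S : Type*} [TopologicalSpace S] {A : S → ℝ → ℝ}

/-- Each line is a union of translates of the fundamental domain [0, A s 0]. A profile copied from φ
is used on that domain for every s and summed over the iterates of A s. -/
theorem IsPushFamily.exists_isTime (h : IsPushFamily A) (s₀ : S) {φ : ℝ → ℝ} (hφc : Continuous φ)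
    (hφm : StrictMono φ) (hφ : ∀ x, φ (A s₀ x) = φ x + 1) :
    ∃ T : S → ℝ → ℝ, IsTime T A ∧ ∀ x, T s₀ x = φ x := by
  choose A' hA' using h.surj
  have hA'A : ∀ s x, A' s (A s x) = x := fun s x => (h.mono s).injective (hA' _ _)
  have hA'c : Continuous (uncurry A') := continuous_uncurry_of_rightInverse h.cont h.mono hA'
  have hA'm : ∀ s, StrictMono (A' s) := fun s x y hxy => by
    rwa [← (h.mono s).lt_iff_lt, hA', hA']
  have hden : ∀ s, 0 < φ (A s 0) - φ 0 := fun s => sub_pos.2 (hφm (h.lt s 0))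
  -- q rises from 0 to 1 across the fundamental domain, and θ is q truncated to a ramp. At s₀ the
  -- denominator is 1.
  let q : S → ℝ → ℝ := fun s x => (φ x - φ 0) / (φ (A s 0) - φ 0)
  let θ : S → ℝ → ℝ := fun s x => max 0 (min 1 (q s x))
  have hqm : ∀ s, StrictMono (q s) := fun s x y hxy =>
    div_lt_div_of_pos_right (sub_lt_sub_right (hφm hxy) _) (hden s)
  have hq0 : ∀ s, q s 0 = 0 := fun s => by simp [q]
  have hq1 : ∀ s, q s (A s 0) = 1 := fun s => div_self (hden s).ne'
  have hqc : Continuous (uncurry q) := by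
    refine Continuous.div ((hφc.comp continuous_snd).sub continuous_const)
      ((hφc.comp (h.cont.comp (continuous_fst.prodMk continuous_const))).sub continuous_const) ?_
    exact fun p => (hden p.1).ne'
  have hθc : Continuous (uncurry θ) := continuous_const.max (continuous_const.min hqc)
  have hθ0 : ∀ s x, x ≤ 0 → θ s x = 0 := fun s x hx => by
    have : q s x ≤ 0 := by rw [← hq0 s]; exact (hqm s).monotone hx
    exact max_eq_left ((min_le_right _ _).trans this)
  have hθ1 : ∀ s x, A s 0 ≤ x → θ s x = 1 := fun s x hx => by
    have : 1 ≤ q s x := by rw [← hq1 s]; exact (hqm s).monotone hx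
    simp only [θ, min_eq_left this]
    exact max_eq_right zero_le_one
  have hθnn : ∀ s x, 0 ≤ θ s x := fun s x => le_max_left _ _
  have hθq : ∀ s x, 0 ≤ x → x ≤ A s 0 → θ s x = q s x := fun s x h0 h1 => by
    have h2 : q s x ≤ 1 := by rw [← hq1 s]; exact (hqm s).monotone h1
    have h3 : 0 ≤ q s x := by rw [← hq0 s]; exact (hqm s).monotone h0
    simp only [θ, min_eq_right h2, max_eq_right h3]
  -- The sum of the ramp over all integer iterates diverges. Pairing a backward with a forward
  -- iterate and subtracting 1, the eventual value of the forward ramp, makes it locally finite.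
  let u : S → ℕ → ℝ → ℝ := fun s n x => θ s ((A' s)^[n] x) + θ s ((A s)^[n + 1] x) - 1
  let τ : S → ℝ → ℝ := fun s x => ∑' n, u s n x
  have hback : ∀ s n, ∀ x, x < (A s)^[n] 0 → (A' s)^[n] x < 0 := by
    intro s n
    induction n with
    | zero => exact fun x hx => hx
    | succ n ih =>
      intro x hx
      rw [iterate_succ_apply]
      rw [iterate_succ_apply'] at hx
      apply ih
      have := hA'm s hx
      rwa [hA'A] at this
  have hfwd : ∀ s n x, 0 < (A s)^[n] x → A s 0 ≤ (A s)^[n + 1] x := fun s n x hx => by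
    rw [iterate_succ_apply']; exact ((h.mono s) hx).le
  have hmonoit : ∀ s x, Monotone fun n => (A s)^[n] x := fun s x =>
    monotone_nat_of_le_succ fun n => by rw [iterate_succ_apply']; exact (h.lt s _).le
  have huz : ∀ s N x, x < (A s)^[N] 0 → 0 < (A s)^[N] x → ∀ n, N ≤ n → u s n x = 0 := by
    intro s N x h1 h2 n hn
    have h3 := hback s n x (h1.trans_le (hmonoit s 0 hn))
    have h4 := hfwd s n x (h2.trans_le (hmonoit s x hn))
    simp only [u, hθ0 s _ h3.le, hθ1 s _ h4]
    ring
  have hτsum : ∀ s N x, x < (A s)^[N] 0 → 0 < (A s)^[N] x →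
      τ s x = ∑ n ∈ Finset.range N, u s n x := by
    intro s N x h1 h2
    refine tsum_eq_sum fun n hn => huz s N x h1 h2 n ?_
    simpa using hn
  have hN : ∀ s x, ∃ N, x < (A s)^[N] 0 ∧ 0 < (A s)^[N] x := by
    intro s x
    obtain ⟨n, hn⟩ := exists_lt_iterate (h.cont_apply s) (h.lt s) 0 x
    obtain ⟨m, hm⟩ := exists_lt_iterate (h.cont_apply s) (h.lt s) x 0
    exact ⟨max n m, hn.trans_le (hmonoit s 0 (le_max_left _ _)),
      hm.trans_le (hmonoit s x (le_max_right _ _))⟩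
  have huc : ∀ n, Continuous fun p : S × ℝ => u p.1 n p.2 := fun n =>
    ((hθc.comp (continuous_fst.prodMk (continuous_uncurry_iterate hA'c n))).add
      (hθc.comp (continuous_fst.prodMk (continuous_uncurry_iterate h.cont (n + 1))))).sub
      continuous_const
  have hτc : Continuous (uncurry τ) := by
    rw [continuous_iff_continuousAt]
    rintro ⟨s, x⟩
    obtain ⟨N, h1, h2⟩ := hN s x
    have hs : Continuous fun p : S × ℝ => ∑ n ∈ Finset.range N, u p.1 n p.2 :=
      continuous_finsetSum _ fun n _ => huc n
    refine hs.continuousAt.congr ?_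
    have e1 : ∀ᶠ p : S × ℝ in 𝓝 (s, x), p.2 < (A p.1)^[N] 0 :=
      continuous_snd.continuousAt.eventually_lt
        ((continuous_uncurry_iterate h.cont N).comp
          (continuous_fst.prodMk continuous_const)).continuousAt h1
    have e2 : ∀ᶠ p : S × ℝ in 𝓝 (s, x), 0 < (A p.1)^[N] p.2 :=
      continuousAt_const.eventually_lt (continuous_uncurry_iterate h.cont N).continuousAt h2
    filter_upwards [e1, e2] with p h1 h2
    exact (hτsum p.1 N p.2 h1 h2).symm
  have hτstep : ∀ s x, τ s (A s x) = τ s x + 1 := by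
    intro s x
    obtain ⟨N, h1, h2⟩ := hN s (A s x)
    have h1' : x < (A s)^[N] 0 := (h.lt s x).trans h1
    have h0 : x < (A s)^[N + 1] 0 := h1'.trans_le (hmonoit s 0 N.le_succ)
    have h2' : 0 < (A s)^[N + 1] x := by rwa [iterate_succ_apply]
    have h3 : A s x < (A s)^[N + 1] 0 := h1.trans_le (hmonoit s 0 N.le_succ)
    have h4 : 0 < (A s)^[N + 1] (A s x) := h2.trans_le (hmonoit s _ N.le_succ)
    rw [hτsum s _ _ h0 h2', hτsum s _ _ h3 h4]
    -- Applying A s shifts both kinds of ramps by one index, so the increment telescopes: the first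
    -- boundary term vanishes and the last one is 1 - 0.
    have hd : ∀ n, u s n (A s x) - u s n x =
        (θ s ((A s)^[n + 1 + 1] x) - θ s ((A' s)^[n + 1] (A s x))) -
        (θ s ((A s)^[n + 1] x) - θ s ((A' s)^[n] (A s x))) := fun n => by
      simp only [u, iterate_succ_apply (A s) (n + 1), iterate_succ_apply (A' s), hA'A]
      ring
    have := Finset.sum_range_sub
      (fun n => θ s ((A s)^[n + 1] x) - θ s ((A' s)^[n] (A s x))) (N + 1)
    simp only [← hd, Finset.sum_sub_distrib] at this
    have e1 : θ s ((A s)^[N + 1 + 1] x) = 1 := hθ1 _ _ (hfwd s (N + 1) x h2')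
    have e2 : θ s ((A' s)^[N + 1] (A s x)) = 0 := hθ0 _ _ (hback s _ _ h3).le
    rw [e1, e2] at this
    simp at this
    linarith
  have hnn : ∀ s y, 0 ≤ y → θ s y ≤ τ s y := by
    intro s y hy
    obtain ⟨N, h1, h2⟩ := hN s y
    have h1' : y < (A s)^[N + 1] 0 := h1.trans_le (hmonoit s 0 N.le_succ)
    have h2' : 0 < (A s)^[N + 1] y := h2.trans_le (hmonoit s y N.le_succ)
    have e : ∀ n, u s n y = θ s ((A' s)^[n] y) := fun n => by
      have : A s 0 ≤ (A s)^[n + 1] y := by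
        rw [iterate_succ_apply']
        exact (h.mono s).monotone (hy.trans (hmonoit s y (Nat.zero_le n)))
      simp only [u, hθ1 s _ this]; ring
    rw [hτsum s _ _ h1' h2']
    simp only [e]
    exact Finset.single_le_sum (f := fun n => θ s ((A' s)^[n] y)) (fun n _ => hθnn s _)
      (Finset.mem_range.2 N.succ_pos)
  have hbase : ∀ s x, 0 ≤ x → x < A s 0 → τ s x = q s x := by
    intro s x h0 h1
    have h2 : 0 < (A s)^[1] x := h0.trans_lt (h.lt s x)
    rw [hτsum s 1 x h1 h2]
    simp only [Finset.range_one, Finset.sum_singleton, u]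
    rw [hθ1 s ((A s)^[0 + 1] x) ((h.mono s).monotone h0), iterate_zero, id, hθq s x h0 h1.le]
    ring
  have hτm : ∀ s, StrictMono (τ s) := by
    intro s x
    refine h.induction s (P := fun x => ∀ ⦃y⦄, x < y → τ s x < τ s y) ?_ ?_ x
    · intro x h0 h1 y hxy
      refine lt_of_lt_of_le ?_ (hnn s y (h0.trans hxy.le))
      rw [hbase s x h0 h1]
      rcases le_total y (A s 0) with hy | hy
      · rw [hθq s y (h0.trans hxy.le) hy]; exact hqm s hxy
      · rw [hθ1 s y hy, ← hq1 s]; exact hqm s h1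
    · refine fun x => ⟨fun hx y hxy => ?_, fun hx y hxy => ?_⟩
      · obtain ⟨y, rfl⟩ := h.surj s y
        rw [hτstep, hτstep]
        exact add_lt_add_left (hx ((h.mono s).lt_iff_lt.1 hxy)) 1
      · have := hx (h.mono s hxy)
        rw [hτstep, hτstep] at this
        linarith
  have hτ0 : ∀ s, τ s 0 = 0 := fun s => by rw [hbase s 0 le_rfl (h.lt s 0), hq0]
  have hup : ∀ s (n : ℕ), τ s ((A s)^[n] 0) = n := fun s n => by
    induction n with
    | zero => simpa using hτ0 s
    | succ n ih => rw [iterate_succ_apply', hτstep, ih]; push_cast; ring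
  have hdown : ∀ s (n : ℕ), τ s ((A' s)^[n] 0) = -n := fun s n => by
    induction n with
    | zero => simpa using hτ0 s
    | succ n ih =>
      have := hτstep s ((A' s)^[n + 1] 0)
      rw [iterate_succ_apply', hA', ih] at this
      rw [iterate_succ_apply']; push_cast; linarith
  have hτsurj : ∀ s, Surjective (τ s) := by
    intro s y
    have hc : Continuous (τ s) := hτc.comp (continuous_const.prodMk continuous_id)
    obtain ⟨n, hn⟩ := exists_nat_ge y
    obtain ⟨m, hm⟩ := exists_nat_ge (-y)
    exact mem_range_of_exists_le_of_exists_ge hc ⟨(A' s)^[m] 0, by rw [hdown]; linarith⟩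
      ⟨(A s)^[n] 0, by rw [hup]; exact hn⟩
  refine ⟨fun s x => τ s x + φ 0, ⟨hτc.add continuous_const,
    fun s x y hxy => add_lt_add_left (hτm s hxy) _, fun s y => ?_, fun s x => ?_⟩, ?_⟩
  · obtain ⟨x, hx⟩ := hτsurj s (y - φ 0)
    exact ⟨x, by simp [hx]⟩
  · simp only [hτstep]; ring
  -- On the fundamental domain the ramp at s₀ is φ - φ 0, and both sides gain 1 under A s₀.
  · refine h.induction s₀ (fun x h0 h1 => ?_) fun x => ?_
    · show τ s₀ x + φ 0 = φ x
      rw [hbase s₀ x h0 h1]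
      simp only [q, hφ]
      simp
    · simp only [hτstep, hφ]
      constructor <;> intro hx <;> linarith

end TimeExtension

/-! ### Abstract matchings and their group structure -/

/-- A matching of pairs of points of two lines: an equivalence relation on pairs of points, given
for each pair by an increasing bijection between the two lines, with the eight point property. -/
structure IsMatching (R : ℝ → ℝ → ℝ → ℝ → Prop) : Prop where
  refl : ∀ x x', R x x' x x'
  symm : ∀ {x x' y y'}, R x x' y y' → R y y' x x'
  trans : ∀ {x x' y y' z z'}, R x x' y y' → R y y' z z' → R x x' z z'
  right : ∀ x x' y, ∃ y', R x x' y y'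
  left : ∀ x x' y', ∃ y, R x x' y y'
  unique : ∀ {x x' y y' z'}, R x x' y y' → R x x' y z' → y' = z'
  mono : ∀ {x x' y y' z z'}, R x x' y y' → R x x' z z' → y < z → y' < z'
  eight : ∀ {x₁ x₁' y₁ y₁' x₂ x₂' y₂ y₂'}, R x₁ x₁' y₁ y₁' → R x₂ x₁' y₂ y₁' →
    R x₂ x₂' y₂ y₂' → R x₁ x₂' y₁ y₂'

namespace IsMatching

variable {R : ℝ → ℝ → ℝ → ℝ → Prop}

/-- Once the class of (0, 0) is the diagonal, let m x be the bijection whose graph is the class of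
(0, x). Then m is a group law on the line with neutral element 0, and its Hölder coordinate is the
required φ. -/
theorem exists_orderIso_of_diagonal (h : IsMatching R) (hd : ∀ y, R 0 0 y y) :
    ∃ φ : ℝ ≃o ℝ, ∀ x x' y y', R x x' y y' ↔ φ y - φ x = φ y' - φ x' := by
  choose m hm using h.right 0
  have hzero : ∀ y, m 0 y = y := fun y => h.unique (hm 0 y) (hd y)
  have hzero' : ∀ x, m x 0 = x := fun x => h.unique (hm x 0) (h.refl 0 x)
  -- Associativity is the eight point property for the pairs 0, y on one line and y, m x y on the
  -- other.
  have hassoc : ∀ x y z, m (m x y) z = m x (m y z) := fun x y z =>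
    h.unique (hm _ _) (h.eight (hm y z) (h.trans (h.symm (hd y)) (hd _))
      (h.trans (h.symm (hm x y)) (hm x (m y z))))
  have hinv : ∀ x, ∃ y, m y x = 0 := fun x => by
    obtain ⟨y, hy⟩ := h.right x 0 0
    exact ⟨y, h.unique (hm _ _) (h.symm hy)⟩
  choose i hi using hinv
  have hml : ∀ x, StrictMono (m x) := fun x y z hyz => h.mono (hm x y) (hm x z) hyz
  have hms : ∀ x, Surjective (m x) := fun x z => by
    obtain ⟨y, hy⟩ := h.left 0 x z
    exact ⟨y, h.unique (hm _ _) hy⟩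
  have hmc : ∀ x, Continuous (m x) := fun x => (hml x).monotone.continuous_of_surjective (hms x)
  have hi' : ∀ x, m x (i x) = 0 := fun x => by
    have h1 : m (i x) (m x (i x)) = i x := by rw [← hassoc, hi, hzero]
    exact (hml (i x)).injective (by rw [h1, hzero'])
  have hcancel : ∀ {x y z}, m x z = m y z → x = y := fun {x y z} hxy => by
    have := congrArg (fun w => m w (i z)) hxy
    simpa only [hassoc, hi', hzero'] using this
  -- m x - m y is continuous and never zero by cancellation, so it keeps the sign that it has at 0.
  have hmr : ∀ x y z, x < y → m x z < m y z := by
    intro x y z hxy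
    by_contra! hle
    have hc : Continuous fun w => m x w - m y w := (hmc x).sub (hmc y)
    obtain ⟨w, hw⟩ := mem_range_of_exists_le_of_exists_ge (c := 0) hc
      ⟨0, by simp only [hzero']; linarith⟩ ⟨z, by linarith⟩
    exact hxy.ne (hcancel (sub_eq_zero.1 hw))
  obtain ⟨φ, hφm⟩ : ∃ φ : ℝ ≃o ℝ, ∀ x y, φ (m x y) = φ x + φ y := by
    -- ℝ carries a second group law here, so its multiples are spelled out from m and the structure
    -- is passed explicitly instead of the standard one.
    let G : AddGroup ℝ :=
      { add := m, sub := fun x y => m x (i y), sub_eq_add_neg := fun _ _ => rfl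
        zero := 0, neg := i, nsmul := @nsmulRec ℝ ⟨0⟩ ⟨m⟩
        zsmul := @zsmulRec ℝ ⟨0⟩ ⟨m⟩ ⟨i⟩ (@nsmulRec ℝ ⟨0⟩ ⟨m⟩)
        add_assoc := hassoc, zero_add := hzero, add_zero := hzero', neg_add_cancel := hi }
    exact @exists_orderIso_real_of_complete ℝ G _ ⟨fun x y z hyz => (hml x).monotone hyz⟩
      ⟨fun z x y hxy => hxy.eq_or_lt.elim (fun e => by rw [e]) fun hlt => (hmr x y z hlt).le⟩ _ _
  refine ⟨φ, fun x x' y y' => ?_⟩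
  -- The class of (x, x') is the left translation by x' - x, written in the new group.
  have hgx : m (m x' (i x)) x = x' := by rw [hassoc, hi, hzero']
  have h1 : R 0 (m x' (i x)) x x' := by simpa only [hgx] using hm (m x' (i x)) x
  have h2 : R x x' y (m (m x' (i x)) y) := h.trans (h.symm h1) (hm _ _)
  have h3 : φ (m (m x' (i x)) y) = φ x' - φ x + φ y := by
    have := congrArg φ hgx
    rw [hφm] at this ⊢
    linarith
  constructor
  · intro h4
    rw [h.unique h4 h2, h3]; ring
  · intro h4
    have : y' = m (m x' (i x)) y := φ.injective (by rw [h3]; linarith)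
    rwa [this]

/-- The class of (0, 0) identifies the first line with the second, which reduces to the diagonal
case. -/
theorem exists_orderIso (h : IsMatching R) :
    ∃ φ φ' : ℝ ≃o ℝ, ∀ x x' y y', R x x' y y' ↔ φ y - φ x = φ' y' - φ' x' := by
  choose k hk using h.right 0 0
  have hkm : StrictMono k := fun y z hyz => h.mono (hk y) (hk z) hyz
  have hks : Surjective k := fun z => by
    obtain ⟨y, hy⟩ := h.left 0 0 z
    exact ⟨y, h.unique (hk _) hy⟩
  let e : ℝ ≃o ℝ := hkm.orderIsoOfSurjective k hks
  have hke : ∀ y, R 0 0 y (e y) := hk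
  have he : ∀ y, R 0 0 (e.symm y) y := fun y => by simpa using hke (e.symm y)
  have he0 : e.symm 0 = 0 := by
    rw [e.symm_apply_eq]
    exact h.unique (h.refl 0 0) (hke 0)
  have h' : IsMatching fun x x' y y' => R (e.symm x) x' (e.symm y) y' :=
    { refl := fun _ _ => h.refl _ _
      symm := h.symm
      trans := h.trans
      right := fun x x' y => h.right _ _ _
      left := fun x x' y' => by
        obtain ⟨y, hy⟩ := h.left (e.symm x) x' y'
        exact ⟨e y, by simpa using hy⟩
      unique := h.unique
      mono := fun h1 h2 h3 => h.mono h1 h2 (e.symm.strictMono h3)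
      eight := h.eight }
  obtain ⟨φ, hφ⟩ := h'.exists_orderIso_of_diagonal (fun y => by rw [he0]; exact he y)
  refine ⟨e.trans φ, φ, fun x x' y y' => ?_⟩
  simpa using hφ (e x) x' (e y) y'

/-- Since every (x, x') is related to (α x, β x'), the displacements of α and β in the coordinates
are one common constant, positive because α moves forward. Dividing by it makes both unit
translations. -/
theorem exists_orderIso_normalized (h : IsMatching R) {α β : ℝ → ℝ} (hα : ∀ x, x < α x)
    (hR : ∀ x x', R x x' (α x) (β x')) :
    ∃ φ φ' : ℝ ≃o ℝ, (∀ x x' y y', R x x' y y' ↔ φ y - φ x = φ' y' - φ' x') ∧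
      (∀ x, φ (α x) = φ x + 1) ∧ ∀ x, φ' (β x) = φ' x + 1 := by
  obtain ⟨φ, φ', hφ⟩ := h.exists_orderIso
  have hω : 0 < φ (α 0) - φ 0 := sub_pos.2 (φ.strictMono (hα 0))
  have hβ : ∀ x', φ' (β x') - φ' x' = φ (α 0) - φ 0 := fun x' => ((hφ _ _ _ _).1 (hR 0 x')).symm
  have hα' : ∀ x, φ (α x) - φ x = φ (α 0) - φ 0 := fun x =>
    ((hφ _ _ _ _).1 (hR x 0)).trans (hβ 0)
  let d : ℝ ≃o ℝ := (OrderIso.mulRight₀ _ (inv_pos.2 hω))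
  refine ⟨φ.trans d, φ'.trans d, fun x x' y y' => ?_, fun x => ?_, fun x => ?_⟩
  · rw [hφ]
    simp only [d, OrderIso.trans_apply, OrderIso.mulRight₀_apply, ← sub_mul]
    exact (mul_left_inj' (inv_pos.2 hω).ne').symm
  · have := hα' x
    simp only [d, OrderIso.trans_apply, OrderIso.mulRight₀_apply]
    rw [show φ (α x) = φ x + (φ (α 0) - φ 0) by linarith, add_mul, mul_inv_cancel₀ hω.ne']
  · have := hβ x
    simp only [d, OrderIso.trans_apply, OrderIso.mulRight₀_apply]
    rw [show φ' (β x) = φ' x + (φ (α 0) - φ 0) by linarith, add_mul, mul_inv_cancel₀ hω.ne']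

end IsMatching

/-! ### The homeomorphism in two charts, and sequences of transits -/

/-- The two families describing a homeomorphism of the Reeb foliation in foliated charts around the
nonseparated leaves (both at parameter `0`); the charts overlap over the negative parameters, where
they differ by the translation by `c s`. -/
structure IsReebModel (A B : ℝ → ℝ → ℝ) (c : ℝ → ℝ) : Prop where
  push : IsPushFamily A
  push' : IsPushFamily B
  cont : ContinuousOn c (Set.Iio 0)
  lim : Tendsto c (𝓝[<] 0) atTop
  conj : ∀ s x, s < 0 → A s (x + c s) = B s x + c s

/-- The `n`-th iterate, read from the first chart to the second. -/
def transit (A : ℝ → ℝ → ℝ) (c : ℝ → ℝ) (n : ℕ) (s x : ℝ) : ℝ := (A s)^[n] x - c s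

/-- The four point matching property in charts. -/
def ChartFourPoint (A : ℝ → ℝ → ℝ) (c : ℝ → ℝ) : Prop :=
  ∀ (x x' : ℝ) (s a b : ℕ → ℝ), Tendsto s atTop (𝓝[<] 0) → Tendsto a atTop (𝓝 x) →
    Tendsto (fun k => transit A c k (s k) (a k)) atTop (𝓝 x') →
    ((∃ y, Tendsto b atTop (𝓝 y)) ↔
      ∃ y', Tendsto (fun k => transit A c k (s k) (b k)) atTop (𝓝 y'))

/-- The relation `∼_f` in charts. -/
def ChartSim (A : ℝ → ℝ → ℝ) (c : ℝ → ℝ) (x x' y y' : ℝ) : Prop :=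
  ∃ s a b : ℕ → ℝ, Tendsto s atTop (𝓝[<] 0) ∧ Tendsto a atTop (𝓝 x) ∧ Tendsto b atTop (𝓝 y) ∧
    Tendsto (fun k => transit A c k (s k) (a k)) atTop (𝓝 x') ∧
    Tendsto (fun k => transit A c k (s k) (b k)) atTop (𝓝 y')

/-- For filling a sequence known only at the indices κ j up to a full one with the same limit. The
matching conditions tie the number of iterations to the index, so they apply to full sequences only.
-/
theorem tendsto_extend {X : Type*} {L : Filter X} {κ : ℕ → ℕ} (hκ : StrictMono κ) {u e : ℕ → X}
    (hu : Tendsto u atTop L) (he : Tendsto e atTop L) : Tendsto (extend κ u e) atTop L := by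
  intro U hU
  obtain ⟨J, hJ⟩ := eventually_atTop.1 (hu hU)
  obtain ⟨K, hK⟩ := eventually_atTop.1 (he hU)
  refine eventually_atTop.2 ⟨max (κ J) K, fun k hk => ?_⟩
  by_cases h : ∃ j, κ j = k
  · obtain ⟨j, rfl⟩ := h
    rw [hκ.injective.extend_apply]
    exact hJ j (hκ.le_iff_le.1 ((le_max_left _ _).trans hk))
  · rw [extend_apply' _ _ _ h]
    exact hK k ((le_max_right _ _).trans hk)

theorem transit_extend (A : ℝ → ℝ → ℝ) (c : ℝ → ℝ) {κ : ℕ → ℕ} (hκ : StrictMono κ)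
    (s s₀ a a₀ : ℕ → ℝ) :
    (fun k => transit A c k (extend κ s s₀ k) (extend κ a a₀ k)) =
      extend κ (fun j => transit A c (κ j) (s j) (a j)) fun k => transit A c k (s₀ k) (a₀ k) := by
  funext k
  by_cases h : ∃ j, κ j = k
  · obtain ⟨j, rfl⟩ := h
    simp only [hκ.injective.extend_apply]
  · simp only [extend_apply' _ _ _ h]

theorem IsPushFamily.iterate_strictMono {S : Type*} [TopologicalSpace S] {A : S → ℝ → ℝ}
    (h : IsPushFamily A) (s : S) (x : ℝ) : StrictMono fun n => (A s)^[n] x :=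
  strictMono_nat_of_lt_succ fun n => by rw [iterate_succ_apply']; exact h.lt s _

theorem IsTime.tendsto_iff {S : Type*} [TopologicalSpace S] {T A : S → ℝ → ℝ} (h : IsTime T A)
    {s : ℕ → S} {s₀ : S} (hs : Tendsto s atTop (𝓝 s₀)) {a : ℕ → ℝ} {x : ℝ} :
    Tendsto a atTop (𝓝 x) ↔ Tendsto (fun k => T (s k) (a k)) atTop (𝓝 (T s₀ x)) := by
  choose G hG using h.surj
  have hGc := continuous_uncurry_of_rightInverse h.cont h.mono hG
  have hGT : ∀ s x, G s (T s x) = x := fun s x => (h.mono s).injective (hG _ _)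
  constructor
  · intro ha
    exact (h.cont.tendsto (s₀, x)).comp (hs.prodMk_nhds ha)
  · intro ha
    have := (hGc.tendsto (s₀, T s₀ x)).comp (hs.prodMk_nhds ha)
    simpa [comp_def, uncurry, hGT] using this

namespace IsReebModel

variable {A B : ℝ → ℝ → ℝ} {c : ℝ → ℝ}

/-- The change of chart commutes with the homeomorphism, so it may be made before iterating instead
of after. -/
theorem transit_eq (h : IsReebModel A B c) {s : ℝ} (hs : s < 0) (n : ℕ) (x : ℝ) :
    transit A c n s x = (B s)^[n] (x - c s) := by
  induction n with
  | zero => rfl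
  | succ n ih =>
    have h1 := h.conj s (transit A c n s x) hs
    rw [transit, iterate_succ_apply', iterate_succ_apply', ← ih]
    rw [transit, sub_add_cancel] at h1
    rw [h1, add_sub_cancel_right, transit]

theorem transit_strictMono (h : IsReebModel A B c) (n : ℕ) (s : ℝ) :
    StrictMono (transit A c n s) := fun _ _ hxy =>
  sub_lt_sub_right (((h.push.mono s).iterate n) hxy) _

theorem tendsto_transit_atBot (h : IsReebModel A B c) (n : ℕ) (x : ℝ) :
    Tendsto (fun s => transit A c n s x) (𝓝[<] 0) atBot := by
  have h1 : Tendsto (fun s => (A s)^[n] x) (𝓝[<] 0) (𝓝 ((A 0)^[n] x)) :=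
    (((continuous_uncurry_iterate h.push.cont n).comp
      (continuous_id.prodMk continuous_const)).tendsto (0 : ℝ)).mono_left nhdsWithin_le_nhds
  exact h1.add_atBot (tendsto_neg_atTop_atBot.comp h.lim)

/-- Intermediate values in s: at a fixed negative parameter many iterations overshoot x', while for
a fixed number of iterations the transit falls to -∞ as s → 0. -/
theorem exists_transit_eq (h : IsReebModel A B c) (x x' : ℝ) {δ : ℝ} (hδ : 0 < δ) :
    ∀ᶠ k in atTop, ∃ s, -δ < s ∧ s < 0 ∧ transit A c k s x = x' := by
  have hneg : -(δ / 2) < 0 := by linarith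
  obtain ⟨N, hN⟩ := exists_lt_iterate (h.push.cont_apply (-(δ / 2))) (h.push.lt _) x
    (x' + c (-(δ / 2)))
  filter_upwards [eventually_ge_atTop N] with k hk
  have h1 : x' < transit A c k (-(δ / 2)) x := by
    have := (h.push.iterate_strictMono (-(δ / 2)) x).monotone hk
    rw [transit]; linarith
  obtain ⟨s₁, hs₁, hs₁'⟩ : ∃ s₁, transit A c k s₁ x < x' ∧ s₁ ∈ Set.Ioo (-(δ / 2)) 0 :=
    (((h.tendsto_transit_atBot k x).eventually_lt_atBot x').and (Ioo_mem_nhdsLT hneg)).exists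
  have hc : ContinuousOn (fun s => transit A c k s x) (Set.Icc (-(δ / 2)) s₁) := by
    refine ContinuousOn.sub ?_ (h.cont.mono fun s hs => lt_of_le_of_lt hs.2 hs₁'.2)
    exact ((continuous_uncurry_iterate h.push.cont k).comp
      (continuous_id.prodMk continuous_const)).continuousOn
  obtain ⟨s, hs, hsx⟩ := intermediate_value_Icc' hs₁'.1.le hc ⟨hs₁.le, h1.le⟩
  exact ⟨s, by linarith [hs.1], hs.2.trans_lt hs₁'.2, hsx⟩

/-- Any two points of the nonseparated leaves are joined by transits along leaves tending to both.
This supplies every sequence on which the matching conditions are tested. -/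
theorem exists_tendsto_transit (h : IsReebModel A B c) (x x' : ℝ) :
    ∃ s : ℕ → ℝ, Tendsto s atTop (𝓝[<] 0) ∧
      Tendsto (fun k => transit A c k (s k) x) atTop (𝓝 x') := by
  let G : ℕ → Set ℝ := fun k => {s | s < 0 ∧ transit A c k s x = x'}
  have hbdd : ∀ k, BddAbove (G k) := fun k => ⟨0, fun s hs => hs.1.le⟩
  -- A solution within 1/(k+1) of the supremum serves all δ at once. Where there is no solution the
  -- value is irrelevant.
  have hex : ∀ k, ∃ s, (G k).Nonempty → s ∈ G k ∧ sSup (G k) - 1 / (k + 1 : ℝ) < s := by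
    intro k
    by_cases hne : (G k).Nonempty
    · obtain ⟨s, hs, hs'⟩ := exists_lt_of_lt_csSup hne
        (sub_lt_self (sSup (G k)) (Nat.one_div_pos_of_nat (n := k) (α := ℝ)))
      exact ⟨s, fun _ => ⟨hs, hs'⟩⟩
    · exact ⟨0, fun hh => absurd hh hne⟩
  choose s hs using hex
  have hev : ∀ δ > 0, ∀ᶠ k in atTop, s k ∈ G k ∧ -δ < s k := by
    intro δ hδ
    have h1 := h.exists_transit_eq x x' (half_pos hδ)
    have h2 : ∀ᶠ k : ℕ in atTop, 1 / ((k : ℝ) + 1) < δ / 2 :=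
      tendsto_one_div_add_atTop_nhds_zero_nat.eventually_lt_const (half_pos hδ)
    filter_upwards [h1, h2] with k ⟨r, hr1, hr2, hr3⟩ hk
    have hrG : r ∈ G k := ⟨hr2, hr3⟩
    obtain ⟨h3, h4⟩ := hs k ⟨r, hrG⟩
    have := le_csSup (hbdd k) hrG
    exact ⟨h3, by linarith⟩
  have hG := hev 1 one_pos
  refine ⟨s, tendsto_nhdsWithin_iff.2 ⟨tendsto_order.2 ⟨fun a ha => ?_, fun a ha => ?_⟩, ?_⟩, ?_⟩
  · filter_upwards [hev (-a) (neg_pos.2 ha)] with k hk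
    simpa using hk.2
  · filter_upwards [hG] with k hk
    exact hk.1.1.trans ha
  · filter_upwards [hG] with k hk
    exact hk.1.1
  · refine tendsto_const_nhds.congr' ?_
    filter_upwards [hG] with k hk
    exact hk.1.2.symm

/-- The form of the four point property for transits with κ j iterations; the missing indices are
filled by `exists_tendsto_transit`. -/
theorem exists_tendsto_transit_subseq (h : IsReebModel A B c) (h4 : ChartFourPoint A c)
    {κ : ℕ → ℕ} (hκ : StrictMono κ) {s a b : ℕ → ℝ} {x x' y : ℝ}
    (hs : Tendsto s atTop (𝓝[<] 0)) (ha : Tendsto a atTop (𝓝 x))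
    (ha' : Tendsto (fun j => transit A c (κ j) (s j) (a j)) atTop (𝓝 x'))
    (hb : Tendsto b atTop (𝓝 y)) :
    ∃ y', ChartSim A c x x' y y' ∧
      Tendsto (fun j => transit A c (κ j) (s j) (b j)) atTop (𝓝 y') := by
  obtain ⟨s₀, hs₀, hx₀⟩ := h.exists_tendsto_transit x x'
  have e1 := tendsto_extend hκ hs hs₀
  have e2 := tendsto_extend hκ ha (tendsto_const_nhds (x := x))
  have e3 := tendsto_extend hκ hb (tendsto_const_nhds (x := y))
  have e4 := tendsto_extend hκ ha' hx₀
  rw [← transit_extend A c hκ] at e4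
  obtain ⟨y', hy'⟩ := (h4 x x' _ _ _ e1 e2 e4).1 ⟨y, e3⟩
  refine ⟨y', ⟨_, _, _, e1, e2, e3, e4, hy'⟩, ?_⟩
  have := hy'.comp hκ.tendsto_atTop
  refine this.congr fun j => ?_
  simp only [comp_apply, hκ.injective.extend_apply]

/-- Interleaving the sequences of the two relations gives one to which the four point property
applies: convergence on one side forces convergence on the other, so the two limits there coincide.
-/
theorem chartSim_left_eq_iff_right_eq (h4 : ChartFourPoint A c) {x x' y y' z z' : ℝ}
    (hy : ChartSim A c x x' y y') (hz : ChartSim A c x x' z z') : y = z ↔ y' = z' := by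
  obtain ⟨s, a, b, hs, ha, hb, ha', hb'⟩ := hy
  obtain ⟨s₀, a₀, b₀, hs₀, ha₀, hb₀, ha₀', hb₀'⟩ := hz
  -- Even indices come from the first relation, odd ones from the second. Each term keeps its own
  -- index, hence its number of iterations.
  have hκ : StrictMono fun j : ℕ => 2 * j := fun i j hij => by simp only; omega
  have hodd : StrictMono fun j : ℕ => 2 * j + 1 := fun i j hij => by simp only; omega
  have hno : ∀ j, ¬∃ i, 2 * i = 2 * j + 1 := fun j ⟨i, hi⟩ => by omega
  have ht := hκ.tendsto_atTop
  have key : ∀ {u e : ℕ → ℝ} {p q : ℝ}, Tendsto u atTop (𝓝 p) → Tendsto e atTop (𝓝 q) →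
      ∀ {r}, Tendsto (extend (fun j : ℕ => 2 * j) (u ∘ fun j => 2 * j) e) atTop (𝓝 r) → p = q := by
    intro u e p q hu he r hr
    have h1 := hr.comp ht
    have h2 := hr.comp hodd.tendsto_atTop
    have h3 := (hu.comp ht).congr (f₂ := extend (fun j : ℕ => 2 * j) (u ∘ fun j => 2 * j) e ∘
      fun j : ℕ => 2 * j) fun j => (hκ.injective.extend_apply _ _ j).symm
    have h4 := (he.comp hodd.tendsto_atTop).congr
      (f₂ := extend (fun j : ℕ => 2 * j) (u ∘ fun j => 2 * j) e ∘
      fun j : ℕ => 2 * j + 1) fun j => (extend_apply' _ _ _ (hno j)).symm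
    exact (tendsto_nhds_unique h3 h1).trans (tendsto_nhds_unique h2 h4)
  have e1 := tendsto_extend hκ (hs.comp ht) hs₀
  have e2 := tendsto_extend hκ (ha.comp ht) ha₀
  have e4 := tendsto_extend hκ (ha'.comp ht) ha₀'
  have r4 := transit_extend A c hκ (s ∘ fun j => 2 * j) s₀ (a ∘ fun j => 2 * j) a₀
  have r5 := transit_extend A c hκ (s ∘ fun j => 2 * j) s₀ (b ∘ fun j => 2 * j) b₀
  have hiff := h4 x x' _ _ (extend (fun j : ℕ => 2 * j) (b ∘ fun j => 2 * j) b₀) e1 e2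
    (by rw [r4]; exact e4)
  rw [r5] at hiff
  constructor
  · rintro rfl
    obtain ⟨w, hw⟩ := hiff.1 ⟨y, tendsto_extend hκ (hb.comp ht) hb₀⟩
    exact key hb' hb₀' hw
  · rintro rfl
    obtain ⟨w, hw⟩ := hiff.2 ⟨y', tendsto_extend hκ (hb'.comp ht) hb₀'⟩
    exact key hb hb₀ hw

/-- Along sequences realizing one relation, any further point can be followed as a constant
sequence; the four point property provides its limit, and uniqueness identifies it. -/
theorem isMatching (h : IsReebModel A B c) (h4 : ChartFourPoint A c)
    (h8 : ∀ x₁ x₁' y₁ y₁' x₂ x₂' y₂ y₂', ChartSim A c x₁ x₁' y₁ y₁' → ChartSim A c x₂ x₁' y₂ y₁' →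
      ChartSim A c x₂ x₂' y₂ y₂' → ChartSim A c x₁ x₂' y₁ y₂') : IsMatching (ChartSim A c) where
  refl x x' := by
    obtain ⟨s, hs, hx⟩ := h.exists_tendsto_transit x x'
    exact ⟨s, _, _, hs, tendsto_const_nhds, tendsto_const_nhds, hx, hx⟩
  symm := fun ⟨s, a, b, hs, ha, hb, ha', hb'⟩ => ⟨s, b, a, hs, hb, ha, hb', ha'⟩
  trans := by
    rintro x x' y y' z z' ⟨s, a, b, hs, ha, hb, ha', hb'⟩ hz
    obtain ⟨w, hw⟩ := (h4 x x' s a (fun _ => z) hs ha ha').1 ⟨z, tendsto_const_nhds⟩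
    have h1 : ChartSim A c y y' z w := ⟨s, b, _, hs, hb, tendsto_const_nhds, hb', hw⟩
    rw [← (chartSim_left_eq_iff_right_eq h4 h1 hz).1 rfl]
    exact ⟨s, a, _, hs, ha, tendsto_const_nhds, ha', hw⟩
  right x x' y := by
    obtain ⟨s, hs, hx⟩ := h.exists_tendsto_transit x x'
    obtain ⟨w, hw⟩ := (h4 x x' s _ (fun _ => y) hs tendsto_const_nhds hx).1 ⟨y, tendsto_const_nhds⟩
    exact ⟨w, s, _, _, hs, tendsto_const_nhds, tendsto_const_nhds, hx, hw⟩
  left x x' y' := by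
    obtain ⟨s, hs, hx⟩ := h.exists_tendsto_transit x x'
    have hsurj : ∀ k, ∃ b, transit A c k (s k) b = y' := fun k => by
      obtain ⟨b, hb⟩ := ((h.push.surj (s k)).iterate k) (y' + c (s k))
      exact ⟨b, by rw [transit, hb, add_sub_cancel_right]⟩
    choose b hb using hsurj
    have hb' : Tendsto (fun k => transit A c k (s k) (b k)) atTop (𝓝 y') := by
      simp only [hb]; exact tendsto_const_nhds
    obtain ⟨w, hw⟩ := (h4 x x' s _ b hs tendsto_const_nhds hx).2 ⟨y', hb'⟩
    exact ⟨w, s, _, b, hs, tendsto_const_nhds, hw, hx, hb'⟩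
  unique h1 h2 := (chartSim_left_eq_iff_right_eq h4 h1 h2).1 rfl
  mono := by
    rintro x x' y y' z z' hy hz hyz
    have hne : y' ≠ z' := fun e => hyz.ne ((chartSim_left_eq_iff_right_eq h4 hy hz).2 e)
    obtain ⟨s, a, b, hs, ha, hb, ha', hb'⟩ := hy
    obtain ⟨w, hw⟩ := (h4 x x' s a (fun _ => z) hs ha ha').1 ⟨z, tendsto_const_nhds⟩
    have h1 : ChartSim A c x x' z w := ⟨s, a, _, hs, ha, tendsto_const_nhds, ha', hw⟩
    rw [(chartSim_left_eq_iff_right_eq h4 h1 hz).1 rfl] at hw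
    refine lt_of_le_of_ne (le_of_tendsto_of_tendsto hb' hw ?_) hne
    filter_upwards [hb.eventually_lt_const hyz] with k hk
    exact (h.transit_strictMono k (s k) hk).le
  eight := h8 _ _ _ _ _ _ _ _

/-- The homeomorphism commutes with its own transits, so it moves a pair within its class. -/
theorem chartSim_step (h : IsReebModel A B c) (x x' : ℝ) :
    ChartSim A c x x' (A 0 x) (B 0 x') := by
  obtain ⟨s, hs, hx⟩ := h.exists_tendsto_transit x x'
  have hs0 : Tendsto s atTop (𝓝 0) := hs.mono_right nhdsWithin_le_nhds
  have hneg : ∀ᶠ k in atTop, s k < 0 := hs self_mem_nhdsWithin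
  refine ⟨s, fun _ => x, fun k => A (s k) x, hs, tendsto_const_nhds,
    (h.push.cont.tendsto (0, x)).comp (hs0.prodMk_nhds tendsto_const_nhds), hx, ?_⟩
  refine ((h.push'.cont.tendsto (0, x')).comp (hs0.prodMk_nhds hx)).congr' ?_
  filter_upwards [hneg] with k hk
  simp only [comp_apply, uncurry]
  rw [h.transit_eq hk, h.transit_eq hk, ← iterate_succ_apply' (B (s k)), iterate_succ_apply]
  have := h.conj (s k) (x - c (s k)) hk
  rw [sub_add_cancel] at this
  rw [this, add_sub_cancel_right]

/-! ### From time functions to the matching properties -/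

section OfTime

variable {T T' : ℝ → ℝ → ℝ} {d : ℝ → ℝ}

theorem time_transit (h : IsReebModel A B c) (hT' : IsTime T' B)
    (hd : ∀ s x, s < 0 → T s (x + c s) = T' s x + d s) {s : ℝ} (hs : s < 0) (n : ℕ) (x : ℝ) :
    T' s (transit A c n s x) = T s x + n - d s := by
  have := hd s (x - c s) hs
  rw [sub_add_cancel] at this
  rw [h.transit_eq hs, hT'.iterate, this]
  ring

/-- By `time_transit`, a transit preserves time differences along a leaf, and convergence of points
is convergence of their times. -/
theorem chartFourPoint_of_time (h : IsReebModel A B c) (hT : IsTime T A) (hT' : IsTime T' B)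
    (hd : ∀ s x, s < 0 → T s (x + c s) = T' s x + d s) : ChartFourPoint A c := by
  intro x x' s a b hs ha ha'
  have hs0 : Tendsto s atTop (𝓝 0) := hs.mono_right nhdsWithin_le_nhds
  have hneg : ∀ᶠ k in atTop, s k < 0 := hs self_mem_nhdsWithin
  have hTa := (hT.tendsto_iff hs0).1 ha
  have hTa' := (hT'.tendsto_iff hs0).1 ha'
  constructor
  · rintro ⟨y, hb⟩
    obtain ⟨y', hy'⟩ := hT'.surj 0 (T' 0 x' + T 0 y - T 0 x)
    refine ⟨y', (hT'.tendsto_iff hs0).2 ?_⟩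
    rw [hy']
    refine ((hTa'.add ((hT.tendsto_iff hs0).1 hb)).sub hTa).congr' ?_
    filter_upwards [hneg] with k hk
    rw [h.time_transit hT' hd hk, h.time_transit hT' hd hk]
    ring
  · rintro ⟨y', hb⟩
    obtain ⟨y, hy⟩ := hT.surj 0 (T 0 x + T' 0 y' - T' 0 x')
    refine ⟨y, (hT.tendsto_iff hs0).2 ?_⟩
    rw [hy]
    refine ((hTa.add ((hT'.tendsto_iff hs0).1 hb)).sub hTa').congr' ?_
    filter_upwards [hneg] with k hk
    rw [h.time_transit hT' hd hk, h.time_transit hT' hd hk]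
    ring

theorem chartSim_iff_of_time (h : IsReebModel A B c) (hT : IsTime T A) (hT' : IsTime T' B)
    (hd : ∀ s x, s < 0 → T s (x + c s) = T' s x + d s) (x x' y y' : ℝ) :
    ChartSim A c x x' y y' ↔ T 0 y - T 0 x = T' 0 y' - T' 0 x' := by
  have h4 := h.chartFourPoint_of_time hT hT' hd
  have key : ∀ y', ChartSim A c x x' y y' → T 0 y - T 0 x = T' 0 y' - T' 0 x' := by
    rintro y' ⟨s, a, b, hs, ha, hb, ha', hb'⟩
    have hs0 : Tendsto s atTop (𝓝 0) := hs.mono_right nhdsWithin_le_nhds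
    have hneg : ∀ᶠ k in atTop, s k < 0 := hs self_mem_nhdsWithin
    refine tendsto_nhds_unique
      (((hT.tendsto_iff hs0).1 hb).sub ((hT.tendsto_iff hs0).1 ha)) ?_
    refine (((hT'.tendsto_iff hs0).1 hb').sub ((hT'.tendsto_iff hs0).1 ha')).congr' ?_
    filter_upwards [hneg] with k hk
    rw [h.time_transit hT' hd hk, h.time_transit hT' hd hk]
    ring
  refine ⟨key y', fun hy => ?_⟩
  obtain ⟨s, hs, hx⟩ := h.exists_tendsto_transit x x'
  obtain ⟨w, hw⟩ := (h4 x x' s _ (fun _ => y) hs tendsto_const_nhds hx).1 ⟨y, tendsto_const_nhds⟩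
  have h1 : ChartSim A c x x' y w :=
    ⟨s, _, _, hs, tendsto_const_nhds, tendsto_const_nhds, hx, hw⟩
  have h2 := key w h1
  have : w = y' := (hT'.mono 0).injective (by linarith)
  rwa [this] at h1

end OfTime

/-! ### From the matching properties to time functions -/

theorem exists_iterate_mem_Icc (h : IsPushFamily B) (s : ℝ) {y : ℝ} (hy : y ≤ 0) :
    ∃ n, (B s)^[n] y ∈ Set.Icc 0 (B s 0) := by
  classical
  have hex : ∃ n, 0 ≤ (B s)^[n] y :=
    (exists_lt_iterate (h.cont_apply s) (h.lt s) y 0).imp fun n hn => hn.le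
  refine ⟨Nat.find hex, Nat.find_spec hex, ?_⟩
  rcases Nat.eq_zero_or_eq_succ_pred (Nat.find hex) with h0 | h0
  · rw [h0]
    exact hy.trans (h.lt s 0).le
  · have := Nat.find_min hex (m := (Nat.find hex).pred) (by omega)
    rw [h0, iterate_succ_apply']
    exact (h.mono s).monotone (not_le.1 this).le

/-- The matching gives compatible coordinates on the two nonseparated leaves. They extend chart by
chart, and the point is continuity when curves approach the first of these leaves. -/
theorem exists_time (h : IsReebModel A B c) (h4 : ChartFourPoint A c)
    (h8 : ∀ x₁ x₁' y₁ y₁' x₂ x₂' y₂ y₂', ChartSim A c x₁ x₁' y₁ y₁' → ChartSim A c x₂ x₁' y₂ y₁' →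
      ChartSim A c x₂ x₂' y₂ y₂' → ChartSim A c x₁ x₂' y₁ y₂') :
    ∃ (T T' : ℝ → ℝ → ℝ) (d : ℝ → ℝ), IsTime T A ∧ IsTime T' B ∧
      ∀ s x, s < 0 → T s (x + c s) = T' s x + d s := by
  obtain ⟨φ, φ', hφ, hφA, hφB⟩ :=
    (h.isMatching h4 h8).exists_orderIso_normalized (h.push.lt 0) h.chartSim_step
  obtain ⟨T', hT', hT'0⟩ := h.push'.exists_isTime 0 φ'.continuous φ'.strictMono hφB
  obtain ⟨T₁, hT₁, hT₁0⟩ := h.push.exists_isTime 0 φ.continuous φ.strictMono hφA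
  -- On the curves T is T' read in the first chart, with constant chosen so that T s 0 = φ 0. Only
  -- the limit s → 0 from below is delicate.
  let T : ℝ → ℝ → ℝ := fun s x =>
    if s < 0 then T' s (x - c s) - T' s (-c s) + φ 0 else T₁ s x
  have hTneg : ∀ s x, s < 0 → T s x = T' s (x - c s) - T' s (-c s) + φ 0 := fun s x hs => if_pos hs
  have hTpos : ∀ s x, 0 ≤ s → T s x = T₁ s x := fun s x hs => if_neg (not_lt.2 hs)
  have hleft : ∀ x, Tendsto (uncurry T) (𝓝[{p | p.1 < 0}] ((0 : ℝ), x)) (𝓝 (φ x)) := by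
    intro x
    refine tendsto_of_subseq_tendsto fun ns hns => ?_
    obtain ⟨hns0, hnsneg⟩ := tendsto_nhdsWithin_iff.1 hns
    have hs0 : Tendsto (fun j => (ns j).1) atTop (𝓝 0) := (continuous_fst.tendsto _).comp hns0
    have hb : Tendsto (fun j => (ns j).2) atTop (𝓝 x) := (continuous_snd.tendsto _).comp hns0
    have hs : Tendsto (fun j => (ns j).1) atTop (𝓝[<] 0) := tendsto_nhdsWithin_iff.2 ⟨hs0, hnsneg⟩
    have hcpos : ∀ᶠ j in atTop, 0 < c (ns j).1 := (h.lim.comp hs).eventually_gt_atTop 0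
    -- n j iterations bring the point 0 into a fundamental domain of the second chart, where
    -- compactness applies. The value is irrelevant for the finitely many other j.
    have hn : ∀ j, ∃ n, (ns j).1 < 0 → 0 < c (ns j).1 →
        transit A c n (ns j).1 0 ∈ Set.Icc 0 (B (ns j).1 0) := by
      intro j
      by_cases hj : (ns j).1 < 0 ∧ 0 < c (ns j).1
      · obtain ⟨n, hn⟩ := exists_iterate_mem_Icc h.push' (ns j).1 (y := 0 - c (ns j).1)
          (by linarith [hj.2])
        exact ⟨n, fun _ _ => by rwa [h.transit_eq hj.1]⟩
      · exact ⟨0, fun h1 h2 => absurd ⟨h1, h2⟩ hj⟩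
    choose n hn using hn
    have hn' : ∀ᶠ j in atTop, transit A c (n j) (ns j).1 0 ∈ Set.Icc 0 (B (ns j).1 0) := by
      filter_upwards [hnsneg, hcpos] with j h1 h2 using hn j h1 h2
    have hninf : Tendsto n atTop atTop := by
      refine tendsto_atTop.2 fun N => ?_
      have h1 : ∀ᶠ j in atTop, transit A c N (ns j).1 0 < 0 :=
        ((h.tendsto_transit_atBot N 0).comp hs).eventually_lt_atBot 0
      filter_upwards [h1, hn'] with j hj hj'
      by_contra! hlt
      have h2 := (h.push.iterate_strictMono (ns j).1 0).monotone hlt.le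
      have h3 := hj'.1
      simp only [transit] at hj h2 h3
      linarith
    have hB : Tendsto (fun j => B (ns j).1 0) atTop (𝓝 (B 0 0)) :=
      (h.push'.cont.tendsto (0, 0)).comp (hs0.prodMk_nhds tendsto_const_nhds)
    have hcomp : ∀ᶠ j in atTop, transit A c (n j) (ns j).1 0 ∈ Set.Icc 0 (B 0 0 + 1) := by
      filter_upwards [hn', hB.eventually_lt_const (lt_add_one _)] with j h1 h2
      exact ⟨h1.1, h1.2.trans h2.le⟩
    obtain ⟨x', -, ψ, hψ, hx'⟩ := isCompact_Icc.tendsto_subseq' hcomp.frequently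
    -- The iteration numbers must increase strictly for the subsequence form of the four point
    -- property.
    obtain ⟨χ, hχ, hκ⟩ := strictMono_subseq_of_tendsto_atTop (hninf.comp hψ.tendsto_atTop)
    have hm : Tendsto (fun j => ψ (χ j)) atTop atTop := hψ.tendsto_atTop.comp hχ.tendsto_atTop
    have hx'' := hx'.comp hχ.tendsto_atTop
    obtain ⟨y', hsim, hy'⟩ := h.exists_tendsto_transit_subseq h4 hκ (hs.comp hm)
      (tendsto_const_nhds (x := (0 : ℝ))) hx'' (hb.comp hm)
    refine ⟨fun j => ψ (χ j), ?_⟩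
    have hsm := hs0.comp hm
    have h1 := ((hT'.tendsto_iff hsm).1 hy').sub ((hT'.tendsto_iff hsm).1 hx'')
    -- The limit points satisfy (0, x') ∼ (x, y'), and the coordinates turn this into equality of
    -- differences.
    have h2 : φ x = T' 0 y' - T' 0 x' + φ 0 := by
      rw [hT'0, hT'0, ← (hφ _ _ _ _).1 hsim]; ring
    rw [h2]
    refine (h1.add_const (φ 0)).congr' ?_
    filter_upwards [hm.eventually hnsneg] with j hj
    simp only [comp_apply, uncurry]
    rw [hTneg _ _ hj, h.transit_eq hj, h.transit_eq hj, hT'.iterate, hT'.iterate, zero_sub]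
    ring
  have hright : ∀ x, Tendsto (uncurry T) (𝓝[{p | 0 ≤ p.1}] ((0 : ℝ), x)) (𝓝 (φ x)) := by
    intro x
    have := (hT₁.cont.tendsto (0, x)).mono_left (nhdsWithin_le_nhds (s := {p | 0 ≤ p.1}))
    rw [uncurry_apply_pair, hT₁0] at this
    refine this.congr' ?_
    filter_upwards [self_mem_nhdsWithin] with p hp
    exact (hTpos p.1 p.2 hp).symm
  have hT : IsTime T A := by
    refine ⟨?_, fun s x y hxy => ?_, fun s y => ?_, fun s x => ?_⟩
    · rw [continuous_iff_continuousAt]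
      rintro ⟨s, x⟩
      rcases lt_trichotomy s 0 with hs | rfl | hs
      · have hc : ContinuousAt (fun p : ℝ × ℝ => c p.1) (s, x) :=
          ContinuousAt.comp (f := Prod.fst) (h.cont.continuousAt (Iio_mem_nhds hs))
            continuous_fst.continuousAt
        have h1 : ContinuousAt (fun p : ℝ × ℝ =>
            T' p.1 (p.2 - c p.1) - T' p.1 (-c p.1) + φ 0) (s, x) := by
          refine ContinuousAt.add (ContinuousAt.sub ?_ ?_) continuousAt_const
          · exact ContinuousAt.comp (g := uncurry T') (f := fun p : ℝ × ℝ => (p.1, p.2 - c p.1))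
              hT'.cont.continuousAt
              (continuous_fst.continuousAt.prodMk (continuous_snd.continuousAt.sub hc))
          · exact ContinuousAt.comp (g := uncurry T') (f := fun p : ℝ × ℝ => (p.1, -c p.1))
              hT'.cont.continuousAt (continuous_fst.continuousAt.prodMk hc.neg)
        refine h1.congr ?_
        filter_upwards [continuous_fst.continuousAt.eventually_lt continuousAt_const hs] with p hp
        exact (hTneg p.1 p.2 hp).symm
      · have hval : uncurry T (0, x) = φ x := (hTpos 0 x le_rfl).trans (hT₁0 x)
        have hu : {p : ℝ × ℝ | p.1 < 0} ∪ {p | 0 ≤ p.1} = Set.univ := by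
          ext p; simpa using lt_or_ge p.1 0
        rw [ContinuousAt, hval, ← nhdsWithin_univ, ← hu, nhdsWithin_union]
        exact (hleft x).sup (hright x)
      · refine (hT₁.cont.continuousAt (x := (s, x))).congr ?_
        filter_upwards [continuousAt_const.eventually_lt continuous_fst.continuousAt hs] with p hp
        exact (hTpos p.1 p.2 (le_of_lt hp)).symm
    · rcases lt_or_ge s 0 with hs | hs
      · rw [hTneg _ _ hs, hTneg _ _ hs]
        have := hT'.mono s (sub_lt_sub_right hxy (c s))
        linarith
      · rw [hTpos _ _ hs, hTpos _ _ hs]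
        exact hT₁.mono s hxy
    · rcases lt_or_ge s 0 with hs | hs
      · obtain ⟨x, hx⟩ := hT'.surj s (y + T' s (-c s) - φ 0)
        exact ⟨x + c s, by rw [hTneg _ _ hs, add_sub_cancel_right, hx]; ring⟩
      · obtain ⟨x, hx⟩ := hT₁.surj s y
        exact ⟨x, by rw [hTpos _ _ hs, hx]⟩
    · rcases lt_or_ge s 0 with hs | hs
      · have := h.conj s (x - c s) hs
        rw [sub_add_cancel] at this
        rw [hTneg _ _ hs, hTneg _ _ hs, this, add_sub_cancel_right, hT'.step]
        ring
      · rw [hTpos _ _ hs, hTpos _ _ hs, hT₁.step]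
  refine ⟨T, T', fun s => -T' s (-c s) + φ 0, hT, hT', fun s x hs => ?_⟩
  rw [hTneg _ _ hs, add_sub_cancel_right]
  ring

end IsReebModel

/-! ### A global coordinate along the curved leaves -/

section Secant

theorem cos_pos_of_mem {y : ℝ} (h : y ∈ Set.Ioo (-1 : ℝ) 1) : 0 < Real.cos (Real.pi / 2 * y) :=
  Real.cos_pos_of_mem_Ioo ⟨by nlinarith [Real.pi_pos, h.1], by nlinarith [Real.pi_pos, h.2]⟩

/-- The signed height `±(1 / cos (π y / 2) - 1)`, increasing from `-∞` to `∞` on `(-1, 1)`. -/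
noncomputable def signedSec (y : ℝ) : ℝ :=
  if 0 ≤ y then (Real.cos (Real.pi / 2 * y))⁻¹ - 1 else 1 - (Real.cos (Real.pi / 2 * y))⁻¹

theorem signedSec_neg (y : ℝ) : signedSec (-y) = -signedSec y := by
  rcases lt_trichotomy y 0 with h | rfl | h
  · rw [signedSec, signedSec, if_pos (by linarith), if_neg (by linarith), mul_neg, Real.cos_neg]
    ring
  · simp [signedSec]
  · rw [signedSec, signedSec, if_neg (by linarith), if_pos h.le, mul_neg, Real.cos_neg]
    ring

theorem abs_signedSec {y : ℝ} (h : y ∈ Set.Ioo (-1 : ℝ) 1) :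
    |signedSec y| = (Real.cos (Real.pi / 2 * y))⁻¹ - 1 := by
  have h1 : 1 ≤ (Real.cos (Real.pi / 2 * y))⁻¹ :=
    (one_le_inv₀ (cos_pos_of_mem h)).2 (Real.cos_le_one _)
  rw [signedSec]
  split_ifs
  · exact abs_of_nonneg (by linarith)
  · rw [abs_of_nonpos (by linarith)]; ring

theorem signedSec_lt_of_nonneg {x y : ℝ} (hx : 0 ≤ x) (hxy : x < y) (hy : y < 1) :
    signedSec x < signedSec y := by
  rw [signedSec, signedSec, if_pos hx, if_pos (hx.trans hxy.le)]
  have hp := Real.pi_pos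
  have h1 : Real.cos (Real.pi / 2 * y) < Real.cos (Real.pi / 2 * x) :=
    Real.strictAntiOn_cos ⟨by positivity, by nlinarith⟩ ⟨by nlinarith, by nlinarith⟩
      (by nlinarith)
  have := (inv_lt_inv₀ (cos_pos_of_mem ⟨by linarith, by linarith⟩)
    (cos_pos_of_mem ⟨by linarith, by linarith⟩)).2 h1
  linarith

theorem signedSec_strictMonoOn : StrictMonoOn signedSec (Set.Ioo (-1) 1) := by
  intro x hx y hy hxy
  rcases le_or_gt 0 x with h0 | h0
  · exact signedSec_lt_of_nonneg h0 hxy hy.2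
  rcases le_or_gt y 0 with h1 | h1
  · have := signedSec_lt_of_nonneg (x := -y) (y := -x) (by linarith) (by linarith)
      (by linarith [hx.1])
    rw [signedSec_neg, signedSec_neg] at this
    linarith
  · have e0 : signedSec 0 = 0 := by simp [signedSec]
    have h2 := signedSec_lt_of_nonneg le_rfl h1 hy.2
    have h3 := signedSec_lt_of_nonneg (x := 0) (y := -x) le_rfl (by linarith) (by linarith [hx.1])
    rw [signedSec_neg] at h3
    linarith

theorem exists_signedSec_eq (w : ℝ) : ∃ y ∈ Set.Ioo (-1 : ℝ) 1, signedSec y = w := by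
  have key : ∀ w : ℝ, 0 ≤ w → ∃ y ∈ Set.Ioo (-1 : ℝ) 1, signedSec y = w := by
    intro w hw
    have hpos : 0 < (1 + w)⁻¹ := by positivity
    have hle : (1 + w)⁻¹ ≤ 1 := inv_le_one_of_one_le₀ (by linarith)
    have h0 := Real.arccos_nonneg (1 + w)⁻¹
    have h1 := Real.arccos_lt_pi_div_two.2 hpos
    have hp := Real.pi_pos
    have hy0 : 0 ≤ 2 / Real.pi * Real.arccos (1 + w)⁻¹ := by positivity
    have hy1 : 2 / Real.pi * Real.arccos (1 + w)⁻¹ < 1 := by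
      rw [div_mul_eq_mul_div, div_lt_one hp]; linarith
    refine ⟨_, ⟨by linarith, hy1⟩, ?_⟩
    have e : Real.pi / 2 * (2 / Real.pi * Real.arccos (1 + w)⁻¹) = Real.arccos (1 + w)⁻¹ := by
      field_simp
    rw [signedSec, if_pos hy0, e, Real.cos_arccos (by linarith) hle, inv_inv]
    ring
  rcases le_total 0 w with hw | hw
  · exact key w hw
  · obtain ⟨y, hy, hyw⟩ := key (-w) (by linarith)
    exact ⟨-y, ⟨by linarith [hy.2], by linarith [hy.1]⟩, by rw [signedSec_neg, hyw, neg_neg]⟩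

/-- `signedSec` as an order isomorphism. -/
noncomputable def signedSecIso : Set.Ioo (-1 : ℝ) 1 ≃o ℝ :=
  StrictMono.orderIsoOfSurjective (fun y : Set.Ioo (-1 : ℝ) 1 => signedSec y)
    (fun x y hxy => signedSec_strictMonoOn x.2 y.2 hxy)
    fun w => by
      obtain ⟨y, hy, h⟩ := exists_signedSec_eq w
      exact ⟨⟨y, hy⟩, h⟩

/-- The inverse of `signedSec`. -/
noncomputable def height (w : ℝ) : ℝ := signedSecIso.symm w

theorem height_mem (w : ℝ) : height w ∈ Set.Ioo (-1 : ℝ) 1 := (signedSecIso.symm w).2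

theorem signedSec_height (w : ℝ) : signedSec (height w) = w := signedSecIso.apply_symm_apply w

theorem height_signedSec {y : ℝ} (h : y ∈ Set.Ioo (-1 : ℝ) 1) : height (signedSec y) = y :=
  congrArg Subtype.val (signedSecIso.symm_apply_apply ⟨y, h⟩)

theorem height_strictMono : StrictMono height := fun _ _ h => signedSecIso.symm.strictMono h

theorem height_continuous : Continuous height :=
  continuous_subtype_val.comp signedSecIso.symm.continuous

theorem height_neg (w : ℝ) : height (-w) = -height w := by
  have h := height_mem w
  rw [← height_signedSec (y := -height w) ⟨by linarith [h.2], by linarith [h.1]⟩, signedSec_neg,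
    signedSec_height]

theorem inv_cos_height (w : ℝ) : (Real.cos (Real.pi / 2 * height w))⁻¹ = 1 + |w| := by
  have := abs_signedSec (height_mem w)
  rw [signedSec_height] at this
  linarith

theorem signedSec_continuousOn : ContinuousOn signedSec (Set.Ioo (-1) 1) :=
  continuousOn_iff_continuous_domRestrict.2 signedSecIso.continuous

theorem height_tendsto_atBot : Tendsto height atBot (𝓝 (-1)) := by
  refine tendsto_order.2 ⟨fun a ha => Eventually.of_forall fun w => ha.trans (height_mem w).1,
    fun a ha => ?_⟩
  filter_upwards [eventually_le_atBot (signedSec (min ((a + -1) / 2) 0))] with w hw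
  have h1 : min ((a + -1) / 2) 0 ∈ Set.Ioo (-1 : ℝ) 1 :=
    ⟨lt_min (by linarith) (by linarith), (min_le_right _ _).trans_lt one_pos⟩
  have h2 := height_strictMono.monotone hw
  rw [height_signedSec h1] at h2
  have := min_le_left ((a + -1) / 2) 0
  linarith

theorem signedSec_tendsto : Tendsto signedSec (𝓝[>] (-1)) atBot := by
  refine tendsto_atBot.2 fun M => ?_
  filter_upwards [Ioo_mem_nhdsGT (height_mem M).1] with y hy
  have := signedSec_strictMonoOn ⟨hy.1, hy.2.trans (height_mem M).2⟩ (height_mem M) hy.2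
  rw [signedSec_height] at this
  exact this.le

end Secant

/-! ### Leaves, their order, and the reflection symmetry -/

section Leaves

/-- With w as signed height, both ends of a curve become rays on which the first coordinate is
affine in w with slope ±1. -/
theorem mem_curveLeaf_iff {u : ℝ} {p : Plane} :
    p ∈ curveLeaf u ↔ ∃ w, p = (u - 1 - |w|, height w) := by
  constructor
  · rintro ⟨t, h1, h2, rfl⟩
    refine ⟨signedSec t, ?_⟩
    rw [abs_signedSec ⟨h1, h2⟩, height_signedSec ⟨h1, h2⟩]
    congr 1; ring
  · rintro ⟨w, rfl⟩
    refine ⟨height w, (height_mem w).1, (height_mem w).2, ?_⟩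
    rw [inv_cos_height]
    congr 1; ring

theorem exists_mem_leaves (p : Plane) : ∃ L ∈ leaves, p ∈ L := by
  by_cases h : 1 ≤ |p.2|
  · exact ⟨_, Or.inl ⟨p.2, h, rfl⟩, p.1, rfl⟩
  · rw [not_le, abs_lt] at h
    refine ⟨_, Or.inr ⟨p.1 + (Real.cos (Real.pi / 2 * p.2))⁻¹, rfl⟩, p.2, h.1, h.2, ?_⟩
    simp

theorem leaves_eq_of_mem {L L' : Set Plane} (hL : L ∈ leaves) (hL' : L' ∈ leaves) {p : Plane}
    (hp : p ∈ L) (hp' : p ∈ L') : L = L' := by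
  rcases hL with ⟨v, hv, rfl⟩ | ⟨u, rfl⟩ <;> rcases hL' with ⟨v', hv', rfl⟩ | ⟨u', rfl⟩
  · obtain ⟨t, rfl⟩ := hp
    obtain ⟨t', h⟩ := hp'
    rw [(Prod.mk.inj h).2]
  · obtain ⟨t, rfl⟩ := hp
    obtain ⟨t', h1, h2, h⟩ := hp'
    rw [(Prod.mk.inj h).2] at hv
    exact absurd (abs_lt.2 ⟨h1, h2⟩) (not_lt.2 hv)
  · obtain ⟨t, rfl⟩ := hp'
    obtain ⟨t', h1, h2, h⟩ := hp
    rw [(Prod.mk.inj h).2] at hv'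
    exact absurd (abs_lt.2 ⟨h1, h2⟩) (not_lt.2 hv')
  · obtain ⟨t, -, -, rfl⟩ := hp
    obtain ⟨t', -, -, h⟩ := hp'
    obtain ⟨h1, rfl⟩ := Prod.mk.inj h
    rw [sub_left_inj] at h1
    rw [h1]

theorem Before.exists_leaf {p q : Plane} (h : Before p q) : ∃ L ∈ leaves, p ∈ L ∧ q ∈ L := by
  rcases h with ⟨v, hv, hp, hq, -⟩ | ⟨v, hv, hp, hq, -⟩ | ⟨u, hp, hq, -⟩
  · exact ⟨_, Or.inl ⟨v, by rw [abs_of_neg (by linarith)]; linarith, rfl⟩, hp, hq⟩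
  · exact ⟨_, Or.inl ⟨v, hv.trans (le_abs_self v), rfl⟩, hp, hq⟩
  · exact ⟨_, Or.inr ⟨u, rfl⟩, hp, hq⟩

theorem Before.mem_iff {p q : Plane} (h : Before p q) {L : Set Plane} (hL : L ∈ leaves) :
    p ∈ L ↔ q ∈ L := by
  obtain ⟨L', hL', hp, hq⟩ := h.exists_leaf
  exact ⟨fun hp' => leaves_eq_of_mem hL' hL hp hp' ▸ hq,
    fun hq' => leaves_eq_of_mem hL' hL hq hq' ▸ hp⟩

theorem before_trichotomy {L : Set Plane} (hL : L ∈ leaves) {p q : Plane} (hp : p ∈ L)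
    (hq : q ∈ L) : q = p ∨ Before p q ∨ Before q p := by
  rcases hL with ⟨v, hv, rfl⟩ | ⟨u, rfl⟩
  · have hp0 := hp
    have hq0 := hq
    obtain ⟨t, rfl⟩ := hp
    obtain ⟨t', rfl⟩ := hq
    rcases lt_trichotomy t t' with h | rfl | h
    · rcases le_abs.1 hv with hv | hv
      · exact Or.inr (Or.inr (Or.inr (Or.inl ⟨v, hv, hq0, hp0, h⟩)))
      · exact Or.inr (Or.inl (Or.inl ⟨v, by linarith, hp0, hq0, h⟩))
    · exact Or.inl rfl
    · rcases le_abs.1 hv with hv | hv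
      · exact Or.inr (Or.inl (Or.inr (Or.inl ⟨v, hv, hp0, hq0, h⟩)))
      · exact Or.inr (Or.inr (Or.inl ⟨v, by linarith, hq0, hp0, h⟩))
  · have hp0 := hp
    have hq0 := hq
    obtain ⟨t, -, -, rfl⟩ := hp
    obtain ⟨t', -, -, rfl⟩ := hq
    rcases lt_trichotomy t t' with h | rfl | h
    · exact Or.inr (Or.inl (Or.inr (Or.inr ⟨u, hp0, hq0, h⟩)))
    · exact Or.inl rfl
    · exact Or.inr (Or.inr (Or.inr (Or.inr ⟨u, hq0, hp0, h⟩)))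

theorem mem_leafOf_iff {p q : Plane} : q ∈ leafOf p ↔ q = p ∨ Before p q ∨ Before q p := by
  constructor
  · rintro ⟨L, hL, hp, hq⟩
    exact before_trichotomy hL hp hq
  · rintro (rfl | h | h)
    · obtain ⟨L, hL, hp⟩ := exists_mem_leaves q
      exact ⟨L, hL, hp, hp⟩
    · exact h.exists_leaf
    · obtain ⟨L, hL, hp, hq⟩ := h.exists_leaf
      exact ⟨L, hL, hq, hp⟩

theorem before_line_iff {x v : ℝ} (hv : v ≤ -1) {p q : Plane} (hp : p = (x, v)) :
    (Before p q ↔ ∃ x', x < x' ∧ q = (x', v)) ∧ (Before q p ↔ ∃ x', x' < x ∧ q = (x', v)) := by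
  have hL : lineLeaf v ∈ leaves :=
    Or.inl ⟨v, by rw [abs_of_neg (by linarith)]; linarith, rfl⟩
  have hpL : p ∈ lineLeaf v := ⟨x, hp⟩
  have key : ∀ a b : ℝ, Before (a, v) (b, v) → a < b := by
    rintro a b (⟨_, _, _, _, h⟩ | ⟨v', hv', ⟨t, ht⟩, _⟩ | ⟨u, ⟨t, h1, _, ht⟩, _⟩)
    · exact h
    · have := (Prod.mk.inj ht).2; linarith
    · have := (Prod.mk.inj ht).2; linarith
  refine ⟨⟨fun h => ?_, ?_⟩, ⟨fun h => ?_, ?_⟩⟩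
  · obtain ⟨x', rfl⟩ := (h.mem_iff hL).1 hpL
    subst hp
    exact ⟨x', key _ _ h, rfl⟩
  · rintro ⟨x', h, rfl⟩
    subst hp
    exact Or.inl ⟨v, hv, hpL, ⟨x', rfl⟩, h⟩
  · obtain ⟨x', rfl⟩ := (h.mem_iff hL).2 hpL
    subst hp
    exact ⟨x', key _ _ h, rfl⟩
  · rintro ⟨x', h, rfl⟩
    subst hp
    exact Or.inl ⟨v, hv, ⟨x', rfl⟩, hpL, h⟩

theorem before_curve_iff {u w : ℝ} {p q : Plane} (hp : p = (u - 1 - |w|, height w)) :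
    (Before p q ↔ ∃ w', w < w' ∧ q = (u - 1 - |w'|, height w')) ∧
      (Before q p ↔ ∃ w', w' < w ∧ q = (u - 1 - |w'|, height w')) := by
  have hL : curveLeaf u ∈ leaves := Or.inr ⟨u, rfl⟩
  have hpL : p ∈ curveLeaf u := mem_curveLeaf_iff.2 ⟨w, hp⟩
  have key : ∀ a b : ℝ, Before (u - 1 - |a|, height a) (u - 1 - |b|, height b) → a < b := by
    rintro a b (⟨v', hv', ⟨t, ht⟩, _⟩ | ⟨v', hv', ⟨t, ht⟩, _⟩ | ⟨_, _, _, h⟩)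
    · have := (Prod.mk.inj ht).2; linarith [(height_mem a).1]
    · have := (Prod.mk.inj ht).2; linarith [(height_mem a).2]
    · exact height_strictMono.lt_iff_lt.1 h
  refine ⟨⟨fun h => ?_, ?_⟩, ⟨fun h => ?_, ?_⟩⟩
  · obtain ⟨x', rfl⟩ := mem_curveLeaf_iff.1 ((h.mem_iff hL).1 hpL)
    subst hp
    exact ⟨x', key _ _ h, rfl⟩
  · rintro ⟨w', h, rfl⟩
    subst hp
    exact Or.inr (Or.inr ⟨u, hpL, mem_curveLeaf_iff.2 ⟨w', rfl⟩, height_strictMono h⟩)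
  · obtain ⟨x', rfl⟩ := mem_curveLeaf_iff.1 ((h.mem_iff hL).2 hpL)
    subst hp
    exact ⟨x', key _ _ h, rfl⟩
  · rintro ⟨w', h, rfl⟩
    subst hp
    exact Or.inr (Or.inr ⟨u, mem_curveLeaf_iff.2 ⟨w', rfl⟩, hpL, height_strictMono h⟩)

/-- The reflection exchanging the two nonseparated leaves. -/
def reflect (p : Plane) : Plane := (p.1, -p.2)

theorem reflect_reflect (p : Plane) : reflect (reflect p) = p := by simp [reflect]

theorem reflect_continuous : Continuous reflect := continuous_fst.prodMk continuous_snd.neg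

theorem reflect_mem_lineLeaf {p : Plane} {v : ℝ} (h : p ∈ lineLeaf v) :
    reflect p ∈ lineLeaf (-v) := by
  obtain ⟨t, rfl⟩ := h
  exact ⟨t, rfl⟩

theorem reflect_mem_curveLeaf {p : Plane} {u : ℝ} (h : p ∈ curveLeaf u) :
    reflect p ∈ curveLeaf u := by
  obtain ⟨t, h1, h2, rfl⟩ := h
  exact ⟨-t, by linarith, by linarith, by simp [reflect]⟩

/-- The reflection preserves the foliation but reverses its orientation; hence the sign change in
the second coordinate of `upperPar`. -/
theorem Before.reflect {p q : Plane} (h : Before p q) : Before (reflect q) (reflect p) := by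
  rcases h with ⟨v, hv, hp, hq, h⟩ | ⟨v, hv, hp, hq, h⟩ | ⟨u, hp, hq, h⟩
  · exact Or.inr (Or.inl ⟨-v, by linarith, reflect_mem_lineLeaf hq, reflect_mem_lineLeaf hp, h⟩)
  · exact Or.inl ⟨-v, by linarith, reflect_mem_lineLeaf hq, reflect_mem_lineLeaf hp, h⟩
  · exact Or.inr (Or.inr ⟨u, reflect_mem_curveLeaf hq, reflect_mem_curveLeaf hp, neg_lt_neg h⟩)

theorem before_reflect_iff {p q : Plane} : Before (reflect p) q ↔ Before (reflect q) p :=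
  ⟨fun h => by simpa only [reflect_reflect] using h.reflect,
    fun h => by simpa only [reflect_reflect] using h.reflect⟩

end Leaves

/-! ### The two foliated charts -/

section Charts

/-- `par` parametrizes the open set `Ω` of the plane, with inverse `chart`, so that the leaves are
the lines of constant first coordinate, oriented by the second coordinate. -/
structure IsFoliatedChart (par : ℝ × ℝ → Plane) (chart : Plane → ℝ × ℝ) (Ω : Set Plane) :
    Prop where
  isOpen : IsOpen Ω
  cont : Continuous par
  mem : ∀ z, par z ∈ Ω
  chart_par : ∀ z, chart (par z) = z
  par_chart : ∀ p ∈ Ω, par (chart p) = p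
  chart_cont : ContinuousOn chart Ω
  before : ∀ s x q, Before (par (s, x)) q ↔ ∃ x', x < x' ∧ q = par (s, x')
  after : ∀ s x q, Before q (par (s, x)) ↔ ∃ x', x' < x ∧ q = par (s, x')

/-- The parametrization of the half plane below the leaf `y = 1`. -/
noncomputable def lowerPar (z : ℝ × ℝ) : Plane :=
  if z.1 < 0 then (-Real.log (-z.1) - |z.2 + Real.log (-z.1)|, height (z.2 + Real.log (-z.1)))
  else (z.2, -1 - z.1)

/-- The inverse of `lowerPar`. -/
noncomputable def lowerChart (p : Plane) : ℝ × ℝ :=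
  if -1 < p.2 then
    (-Real.exp (-(p.1 + |signedSec p.2|)), p.1 + |signedSec p.2| + signedSec p.2)
  else (-1 - p.2, p.1)

theorem lowerPar_of_neg {z : ℝ × ℝ} (h : z.1 < 0) : lowerPar z =
    (-Real.log (-z.1) - |z.2 + Real.log (-z.1)|, height (z.2 + Real.log (-z.1))) := if_pos h

theorem lowerPar_of_nonneg {z : ℝ × ℝ} (h : 0 ≤ z.1) : lowerPar z = (z.2, -1 - z.1) :=
  if_neg (not_lt.2 h)

theorem tendsto_log_neg : Tendsto (fun s : ℝ => Real.log (-s)) (𝓝[<] 0) atBot := by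
  have h : Tendsto (fun s : ℝ => -s) (𝓝[<] 0) (𝓝[>] 0) := by
    refine tendsto_nhdsWithin_iff.2 ⟨?_, ?_⟩
    · have := (continuous_neg.tendsto (0 : ℝ)).mono_left (nhdsWithin_le_nhds (s := Set.Iio 0))
      simpa using this
    · filter_upwards [self_mem_nhdsWithin] with s hs
      exact Set.mem_Ioi.2 (neg_pos.2 (Set.mem_Iio.1 hs))
  exact Real.tendsto_log_nhdsGT_zero.comp h

/-- Near s = 0 from below the signed height z.2 + log(-s) is negative. The absolute value then opens
and the first coordinate is exactly z.2, matching the horizontal lines. -/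
theorem lowerPar_continuous : Continuous lowerPar := by
  rw [continuous_iff_continuousAt]
  rintro ⟨s, x⟩
  rcases lt_trichotomy s 0 with hs | rfl | hs
  · have hlog : ContinuousAt (fun z : ℝ × ℝ => Real.log (-z.1)) (s, x) :=
      continuous_fst.neg.continuousAt.log (by simpa using hs.ne)
    have h2 := (continuous_snd.continuousAt (x := (s, x))).add hlog
    have h3 : ContinuousAt (fun z : ℝ × ℝ =>
        ((-Real.log (-z.1) - |z.2 + Real.log (-z.1)|, height (z.2 + Real.log (-z.1))) : Plane))
        (s, x) :=
      (hlog.neg.sub h2.abs).prodMk (height_continuous.continuousAt.comp h2)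
    refine h3.congr ?_
    filter_upwards [continuous_fst.continuousAt.eventually_lt continuousAt_const hs] with z hz
    exact (lowerPar_of_neg hz).symm
  · have hu : {p : ℝ × ℝ | p.1 < 0} ∪ {p | 0 ≤ p.1} = Set.univ := by
      ext p; simpa using lt_or_ge p.1 0
    have hval : lowerPar (0, x) = (x, -1) := by simp [lowerPar]
    rw [ContinuousAt, hval, ← nhdsWithin_univ, ← hu, nhdsWithin_union]
    refine Tendsto.sup ?_ ?_
    · have h1 : Tendsto (fun z : ℝ × ℝ => z.1) (𝓝[{p | p.1 < 0}] (0, x)) (𝓝[<] 0) :=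
        tendsto_nhdsWithin_iff.2 ⟨(continuous_fst.tendsto _).mono_left nhdsWithin_le_nhds,
          self_mem_nhdsWithin⟩
      have h2 : Tendsto (fun z : ℝ × ℝ => z.2) (𝓝[{p | p.1 < 0}] (0, x)) (𝓝 x) :=
        (continuous_snd.tendsto _).mono_left nhdsWithin_le_nhds
      have h3 : Tendsto (fun z : ℝ × ℝ => z.2 + Real.log (-z.1)) (𝓝[{p | p.1 < 0}] (0, x)) atBot :=
        h2.add_atBot (tendsto_log_neg.comp h1)
      refine Tendsto.congr' ?_ (h2.prodMk_nhds (height_tendsto_atBot.comp h3))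
      filter_upwards [self_mem_nhdsWithin, h3.eventually_le_atBot 0] with z hz hz'
      rw [lowerPar_of_neg hz, abs_of_nonpos hz']
      simp
    · have h1 : Continuous fun z : ℝ × ℝ => ((z.2, -1 - z.1) : Plane) :=
        continuous_snd.prodMk (continuous_const.sub continuous_fst)
      have h2 := (h1.tendsto (0, x)).mono_left (nhdsWithin_le_nhds (s := {p : ℝ × ℝ | 0 ≤ p.1}))
      simp only [sub_zero] at h2
      refine h2.congr' ?_
      filter_upwards [self_mem_nhdsWithin] with z hz
      exact (lowerPar_of_nonneg hz).symm
  · have h1 : Continuous fun z : ℝ × ℝ => ((z.2, -1 - z.1) : Plane) :=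
      continuous_snd.prodMk (continuous_const.sub continuous_fst)
    refine h1.continuousAt.congr ?_
    filter_upwards [continuousAt_const.eventually_lt continuous_fst.continuousAt hs] with z hz
    exact (lowerPar_of_nonneg (le_of_lt hz)).symm

theorem lowerChart_of_lt {p : Plane} (h : -1 < p.2) : lowerChart p =
    (-Real.exp (-(p.1 + |signedSec p.2|)), p.1 + |signedSec p.2| + signedSec p.2) := if_pos h

theorem lowerChart_of_le {p : Plane} (h : p.2 ≤ -1) : lowerChart p = (-1 - p.2, p.1) :=
  if_neg (not_lt.2 h)

theorem lowerChart_continuousOn : ContinuousOn lowerChart {p | p.2 < 1} := by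
  rintro ⟨x, y⟩ hy
  apply ContinuousAt.continuousWithinAt
  rcases lt_trichotomy (-1) y with h | rfl | h
  · have h1 : ContinuousAt (fun p : Plane => signedSec p.2) (x, y) :=
      ContinuousAt.comp (f := Prod.snd)
        (signedSec_continuousOn.continuousAt (Ioo_mem_nhds h hy)) continuous_snd.continuousAt
    have h2 := (continuous_fst.continuousAt (x := (x, y))).add h1.abs
    refine (h2.neg.rexp.neg.prodMk (h2.add h1)).congr ?_
    filter_upwards [continuousAt_const.eventually_lt continuous_snd.continuousAt h] with p hp
    exact (lowerChart_of_lt hp).symm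
  · have hu : {p : Plane | -1 < p.2} ∪ {p | p.2 ≤ -1} = Set.univ := by
      ext p; simpa using lt_or_ge (-1) p.2
    have hval : lowerChart (x, -1) = (0, x) := by simp [lowerChart]
    rw [ContinuousAt, hval, ← nhdsWithin_univ, ← hu, nhdsWithin_union]
    refine Tendsto.sup ?_ ?_
    · have h1 : Tendsto (fun p : Plane => p.2) (𝓝[{p | -1 < p.2}] (x, -1)) (𝓝[>] (-1)) :=
        tendsto_nhdsWithin_iff.2 ⟨(continuous_snd.tendsto _).mono_left nhdsWithin_le_nhds,
          self_mem_nhdsWithin⟩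
      have h2 : Tendsto (fun p : Plane => p.1) (𝓝[{p | -1 < p.2}] (x, -1)) (𝓝 x) :=
        (continuous_fst.tendsto _).mono_left nhdsWithin_le_nhds
      have h3 := signedSec_tendsto.comp h1
      have h4 : Tendsto (fun p : Plane => p.1 + |signedSec p.2|) (𝓝[{p | -1 < p.2}] (x, -1))
          atTop := h2.add_atTop (tendsto_abs_atBot_atTop.comp h3)
      have h5 : Tendsto (fun p : Plane => -Real.exp (-(p.1 + |signedSec p.2|)))
          (𝓝[{p | -1 < p.2}] (x, -1)) (𝓝 0) := by
        have := (Real.tendsto_exp_neg_atTop_nhds_zero.comp h4).neg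
        simpa using this
      refine Tendsto.congr' ?_ (h5.prodMk_nhds h2)
      filter_upwards [self_mem_nhdsWithin, h3.eventually_le_atBot 0] with p hp hp'
      have hp'' : signedSec p.2 ≤ 0 := hp'
      rw [lowerChart_of_lt hp, abs_of_nonpos hp'']
      simp
    · have h1 : Continuous fun p : Plane => ((-1 - p.2, p.1) : ℝ × ℝ) :=
        (continuous_const.sub continuous_snd).prodMk continuous_fst
      have h2 := (h1.tendsto (x, -1)).mono_left (nhdsWithin_le_nhds (s := {p : Plane | p.2 ≤ -1}))
      simp only [sub_self] at h2
      refine h2.congr' ?_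
      filter_upwards [self_mem_nhdsWithin] with p hp
      exact (lowerChart_of_le hp).symm
  · have h1 : Continuous fun p : Plane => ((-1 - p.2, p.1) : ℝ × ℝ) :=
      (continuous_const.sub continuous_snd).prodMk continuous_fst
    refine h1.continuousAt.congr ?_
    filter_upwards [continuous_snd.continuousAt.eventually_lt continuousAt_const h] with p hp
    exact (lowerChart_of_le (le_of_lt hp)).symm

theorem lowerPar_snd_lt (z : ℝ × ℝ) : (lowerPar z).2 < 1 := by
  rcases lt_or_ge z.1 0 with h | h
  · rw [lowerPar_of_neg h]; exact (height_mem _).2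
  · rw [lowerPar_of_nonneg h]; simp only; linarith

theorem neg_one_lt_lowerPar_iff (z : ℝ × ℝ) : -1 < (lowerPar z).2 ↔ z.1 < 0 := by
  rcases lt_or_ge z.1 0 with h | h
  · rw [lowerPar_of_neg h]; exact ⟨fun _ => h, fun _ => (height_mem _).1⟩
  · rw [lowerPar_of_nonneg h]
    constructor <;> intro h' <;> simp only at * <;> linarith

theorem lowerChart_lowerPar (z : ℝ × ℝ) : lowerChart (lowerPar z) = z := by
  rcases lt_or_ge z.1 0 with h | h
  · rw [lowerChart_of_lt ((neg_one_lt_lowerPar_iff z).2 h), lowerPar_of_neg h]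
    simp only [signedSec_height, sub_add_cancel, neg_neg]
    rw [Real.exp_log (neg_pos.2 h)]
    ext <;> simp
  · rw [lowerPar_of_nonneg h, lowerChart_of_le (by simp only; linarith)]
    ext <;> simp

theorem lowerPar_lowerChart {p : Plane} (hp : p.2 < 1) : lowerPar (lowerChart p) = p := by
  rcases lt_or_ge (-1) p.2 with h | h
  · rw [lowerChart_of_lt h, lowerPar_of_neg (neg_neg_of_pos (Real.exp_pos _))]
    simp only [neg_neg, Real.log_exp]
    have : p.1 + |signedSec p.2| + signedSec p.2 + -(p.1 + |signedSec p.2|) = signedSec p.2 := by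
      ring
    rw [this, height_signedSec ⟨h, hp⟩]
    ext <;> simp
  · rw [lowerChart_of_le h, lowerPar_of_nonneg (by simp only; linarith)]
    ext <;> simp

theorem before_lowerPar_iff (s x : ℝ) (q : Plane) :
    (Before (lowerPar (s, x)) q ↔ ∃ x', x < x' ∧ q = lowerPar (s, x')) ∧
      (Before q (lowerPar (s, x)) ↔ ∃ x', x' < x ∧ q = lowerPar (s, x')) := by
  rcases lt_or_ge s 0 with h | h
  · have hl : ∀ x, lowerPar (s, x) =
        ((1 - Real.log (-s)) - 1 - |x + Real.log (-s)|, height (x + Real.log (-s))) := fun x => by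
      rw [lowerPar_of_neg h]; congr 1; ring
    have := before_curve_iff (q := q) (hl x)
    rw [this.1, this.2]
    simp only [hl]
    refine ⟨⟨fun ⟨w, h1, h2⟩ => ⟨w - Real.log (-s), by linarith, by rwa [sub_add_cancel]⟩,
      fun ⟨w, h1, h2⟩ => ⟨_, by linarith, h2⟩⟩,
      ⟨fun ⟨w, h1, h2⟩ => ⟨w - Real.log (-s), by linarith, by rwa [sub_add_cancel]⟩,
      fun ⟨w, h1, h2⟩ => ⟨_, by linarith, h2⟩⟩⟩
  · have hl : ∀ x, lowerPar (s, x) = (x, -1 - s) := fun x => lowerPar_of_nonneg h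
    have := before_line_iff (q := q) (v := -1 - s) (by linarith) (hl x)
    rw [this.1, this.2]
    simp only [hl, and_self]

/-- The half plane below the leaf `y = 1`. -/
def lowerHalf : Set Plane := {p | p.2 < 1}

/-- The half plane above the leaf `y = -1`. -/
def upperHalf : Set Plane := {p | -1 < p.2}

theorem isFoliatedChart_lower : IsFoliatedChart lowerPar lowerChart lowerHalf where
  isOpen := isOpen_lt continuous_snd continuous_const
  cont := lowerPar_continuous
  mem := lowerPar_snd_lt
  chart_par := lowerChart_lowerPar
  par_chart _ hp := lowerPar_lowerChart hp
  chart_cont := lowerChart_continuousOn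
  before s x q := (before_lowerPar_iff s x q).1
  after s x q := (before_lowerPar_iff s x q).2

/-- The parametrization of the half plane above the leaf `y = -1`. -/
noncomputable def upperPar (z : ℝ × ℝ) : Plane := reflect (lowerPar (z.1, -z.2))

/-- The inverse of `upperPar`. -/
noncomputable def upperChart (p : Plane) : ℝ × ℝ :=
  ((lowerChart (reflect p)).1, -(lowerChart (reflect p)).2)

theorem reflect_mem_lowerHalf {p : Plane} : reflect p ∈ lowerHalf ↔ p ∈ upperHalf := by
  simp only [lowerHalf, upperHalf, reflect, Set.mem_ofPred_eq]
  constructor <;> intro h <;> linarith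

theorem isFoliatedChart_upper : IsFoliatedChart upperPar upperChart upperHalf where
  isOpen := isOpen_lt continuous_const continuous_snd
  cont := reflect_continuous.comp
    (lowerPar_continuous.comp (continuous_fst.prodMk continuous_snd.neg))
  mem z := by
    rw [← reflect_mem_lowerHalf, upperPar, reflect_reflect]
    exact lowerPar_snd_lt _
  chart_par z := by simp [upperChart, upperPar, reflect_reflect, lowerChart_lowerPar]
  par_chart p hp := by
    simp only [upperChart, upperPar, neg_neg, Prod.mk.eta]
    rw [lowerPar_lowerChart (reflect_mem_lowerHalf.2 hp), reflect_reflect]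
  chart_cont := by
    have h : ContinuousOn (fun p => lowerChart (reflect p)) upperHalf :=
      lowerChart_continuousOn.comp reflect_continuous.continuousOn
        fun p hp => reflect_mem_lowerHalf.2 hp
    exact h.fst.prodMk h.snd.neg
  before s x q := by
    rw [upperPar, before_reflect_iff, (before_lowerPar_iff _ _ _).2]
    constructor
    · rintro ⟨x', h, hq⟩
      exact ⟨-x', by simp only at h; linarith, by
        rw [upperPar, neg_neg, ← hq, reflect_reflect]⟩
    · rintro ⟨x', h, rfl⟩
      exact ⟨-x', by simp only; linarith, by rw [upperPar, reflect_reflect]⟩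
  after s x q := by
    have : Before q (upperPar (s, x)) ↔ Before (lowerPar (s, -x)) (reflect q) := by
      rw [upperPar]
      constructor <;> intro h <;> simpa only [reflect_reflect] using h.reflect
    rw [this, (before_lowerPar_iff _ _ _).1]
    constructor
    · rintro ⟨x', h, hq⟩
      exact ⟨-x', by linarith, by
        rw [upperPar, neg_neg, ← hq, reflect_reflect]⟩
    · rintro ⟨x', h, rfl⟩
      exact ⟨-x', by linarith, by rw [upperPar, reflect_reflect]⟩

/-- The translation relating the two charts on the leaf of parameter `s < 0`. -/
noncomputable def chartShift (s : ℝ) : ℝ := -2 * Real.log (-s)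

theorem chartShift_continuousOn : ContinuousOn chartShift (Set.Iio 0) :=
  continuousOn_const.mul (ContinuousOn.log continuousOn_id.neg fun s hs => by
    simpa using (ne_of_lt hs))

theorem chartShift_tendsto : Tendsto chartShift (𝓝[<] 0) atTop := by
  have := tendsto_log_neg.const_mul_atBot_of_neg (r := -2) (by norm_num)
  exact this

/-- The signed height is x + log(-s) in the lower chart and x - log(-s) in the upper one. -/
theorem upperPar_eq {s : ℝ} (hs : s < 0) (x : ℝ) :
    upperPar (s, x) = lowerPar (s, x + chartShift s) := by
  rw [upperPar, lowerPar_of_neg hs, lowerPar_of_neg hs, chartShift, reflect]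
  have h1 : x + -2 * Real.log (-s) + Real.log (-s) = -(-x + Real.log (-s)) := by ring
  simp only [h1, height_neg, abs_neg]

theorem lowerPar_eq {s : ℝ} (hs : s < 0) (x : ℝ) :
    lowerPar (s, x) = upperPar (s, x - chartShift s) := by
  rw [upperPar_eq hs, sub_add_cancel]

theorem lowerPar_zero (x : ℝ) : lowerPar (0, x) = (x, -1) := by simp [lowerPar]

theorem upperPar_zero (x : ℝ) : upperPar (0, x) = (-x, 1) := by
  simp [upperPar, lowerPar_zero, reflect]

theorem lowerPar_mem_upperHalf_iff (z : ℝ × ℝ) : lowerPar z ∈ upperHalf ↔ z.1 < 0 :=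
  neg_one_lt_lowerPar_iff z

theorem mem_lowerHalf_or_mem_upperHalf (p : Plane) : p ∈ lowerHalf ∨ p ∈ upperHalf := by
  simp only [lowerHalf, upperHalf, Set.mem_ofPred_eq]
  by_contra! h
  linarith [h.1, h.2]

namespace IsFoliatedChart

variable {par : ℝ × ℝ → Plane} {chart : Plane → ℝ × ℝ} {Ω : Set Plane}

theorem injective (h : IsFoliatedChart par chart Ω) : Injective par := fun z w hzw => by
  rw [← h.chart_par z, hzw, h.chart_par]

theorem mem_leafOf (h : IsFoliatedChart par chart Ω) {s x : ℝ} {q : Plane} :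
    q ∈ leafOf (par (s, x)) ↔ ∃ x', q = par (s, x') := by
  rw [mem_leafOf_iff, h.before, h.after]
  constructor
  · rintro (rfl | ⟨x', -, h'⟩ | ⟨x', -, h'⟩)
    exacts [⟨x, rfl⟩, ⟨x', h'⟩, ⟨x', h'⟩]
  · rintro ⟨x', rfl⟩
    rcases lt_trichotomy x x' with hx | rfl | hx
    exacts [Or.inr (Or.inl ⟨x', hx, rfl⟩), Or.inl rfl, Or.inr (Or.inr ⟨x', hx, rfl⟩)]

theorem before_par (h : IsFoliatedChart par chart Ω) {s x x' : ℝ} :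
    Before (par (s, x)) (par (s, x')) ↔ x < x' := by
  rw [h.before]
  constructor
  · rintro ⟨y, hy, he⟩
    rw [(Prod.mk.inj (h.injective he)).2]
    exact hy
  · exact fun hx => ⟨x', hx, rfl⟩

theorem tendsto_chart (h : IsFoliatedChart par chart Ω) {ι : Type*} {l : Filter ι} {a : ι → Plane}
    {z : ℝ × ℝ} (ha : Tendsto a l (𝓝 (par z))) :
    Tendsto (fun i => (chart (a i)).1) l (𝓝 z.1) ∧ Tendsto (fun i => (chart (a i)).2) l (𝓝 z.2) ∧
      ∀ᶠ i in l, par (chart (a i)) = a i := by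
  have h1 := (h.chart_cont.continuousAt (h.isOpen.mem_nhds (h.mem z))).tendsto.comp ha
  rw [h.chart_par] at h1
  refine ⟨(continuous_fst.tendsto _).comp h1, (continuous_snd.tendsto _).comp h1, ?_⟩
  filter_upwards [ha (h.isOpen.mem_nhds (h.mem z))] with i hi
  exact h.par_chart _ hi

theorem tendsto_par_iff (h : IsFoliatedChart par chart Ω) {ι : Type*} {l : Filter ι}
    {s a : ι → ℝ} {s₀ x : ℝ} :
    Tendsto (fun i => par (s i, a i)) l (𝓝 (par (s₀, x))) ↔
      Tendsto s l (𝓝 s₀) ∧ Tendsto a l (𝓝 x) := by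
  constructor
  · intro h1
    have := h.tendsto_chart h1
    simp only [h.chart_par] at this
    exact ⟨this.1, this.2.1⟩
  · rintro ⟨h1, h2⟩
    exact (h.cont.tendsto (s₀, x)).comp (h1.prodMk_nhds h2)

end IsFoliatedChart

end Charts

/-! ### A homeomorphism of the foliation read in a chart -/

section ChartMap

theorem Before.ne {p q : Plane} (h : Before p q) : q ≠ p := by
  rintro rfl
  rcases h with ⟨_, _, _, _, h⟩ | ⟨_, _, _, _, h⟩ | ⟨_, _, _, h⟩ <;> exact lt_irrefl _ h

theorem IsReebHomeo.before {f : Plane ≃ₜ Plane} (hf : IsReebHomeo f) (p : Plane) :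
    Before p (f p) := by
  obtain ⟨L, hL, hp⟩ := exists_mem_leaves p
  exact (hf.2 L hL).2 p hp

/-- The second coordinate of `f` in a chart. -/
def chartMap (par : ℝ × ℝ → Plane) (chart : Plane → ℝ × ℝ) (f : Plane ≃ₜ Plane) (s x : ℝ) : ℝ :=
  (chart (f (par (s, x)))).2

variable {par : ℝ × ℝ → Plane} {chart : Plane → ℝ × ℝ} {Ω : Set Plane} {f : Plane ≃ₜ Plane}

namespace IsFoliatedChart

theorem apply_par (h : IsFoliatedChart par chart Ω) (hf : ∀ p, Before p (f p)) (s x : ℝ) :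
    f (par (s, x)) = par (s, chartMap par chart f s x) := by
  obtain ⟨x', -, hx'⟩ := (h.before s x _).1 (hf (par (s, x)))
  rw [chartMap, hx', h.chart_par]

theorem iterate_par (h : IsFoliatedChart par chart Ω) (hf : ∀ p, Before p (f p)) (s x : ℝ)
    (n : ℕ) : f^[n] (par (s, x)) = par (s, (chartMap par chart f s)^[n] x) := by
  induction n with
  | zero => rfl
  | succ n ih => rw [iterate_succ_apply', iterate_succ_apply', ih, h.apply_par hf]

theorem isPushFamily (h : IsFoliatedChart par chart Ω) (hf : ∀ p, Before p (f p)) :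
    IsPushFamily (chartMap par chart f) := by
  have hcont : Continuous (uncurry (chartMap par chart f)) :=
    continuous_snd.comp (h.chart_cont.comp_continuous (f.continuous.comp h.cont) fun z => by
      rw [h.apply_par hf z.1 z.2]; exact h.mem _)
  have hlt : ∀ s x, x < chartMap par chart f s x := fun s x => by
    have := hf (par (s, x))
    rwa [h.apply_par hf, h.before_par] at this
  refine ⟨hcont, fun s => ?_, fun s y => ?_, hlt⟩
  · have hinj : Injective (chartMap par chart f s) := fun x y hxy => by
      have : f (par (s, x)) = f (par (s, y)) := by rw [h.apply_par hf, h.apply_par hf, hxy]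
      exact (Prod.mk.inj (h.injective (f.injective this))).2
    have hc : Continuous (chartMap par chart f s) :=
      hcont.comp (continuous_const.prodMk continuous_id)
    -- A decreasing map would reverse 0 < g 0 into g (g 0) < g 0, although g moves points forward.
    refine (hc.strictMono_of_inj hinj).resolve_right fun hanti => ?_
    exact lt_asymm (hlt s _) (hanti (hlt s 0))
  · have h1 := hf (f.symm (par (s, y)))
    rw [f.apply_symm_apply] at h1
    obtain ⟨x, -, hx⟩ := (h.after s y _).1 h1
    refine ⟨x, ?_⟩
    rw [chartMap, ← hx, f.apply_symm_apply, h.chart_par]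

end IsFoliatedChart

/-- A homeomorphism in the chart below the leaf `y = 1`. -/
noncomputable abbrev lowerMap (f : Plane ≃ₜ Plane) : ℝ → ℝ → ℝ := chartMap lowerPar lowerChart f

/-- A homeomorphism in the chart above the leaf `y = -1`. -/
noncomputable abbrev upperMap (f : Plane ≃ₜ Plane) : ℝ → ℝ → ℝ := chartMap upperPar upperChart f

theorem isReebModel (hf : ∀ p, Before p (f p)) :
    IsReebModel (lowerMap f) (upperMap f) chartShift where
  push := isFoliatedChart_lower.isPushFamily hf
  push' := isFoliatedChart_upper.isPushFamily hf
  cont := chartShift_continuousOn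
  lim := chartShift_tendsto
  conj s x hs := by
    have h1 := isFoliatedChart_lower.apply_par hf s (x + chartShift s)
    have h2 := isFoliatedChart_upper.apply_par hf s x
    rw [upperPar_eq hs, upperPar_eq hs, h1] at h2
    exact (Prod.mk.inj (isFoliatedChart_lower.injective h2)).2

end ChartMap

/-! ### Matching properties of the plane and of the charts -/

section Matching

variable {f : Plane ≃ₜ Plane}

theorem tendsto_iterate_lowerPar_iff (hf : ∀ p, Before p (f p)) {s a : ℕ → ℝ} {x' : ℝ}
    (hs : Tendsto s atTop (𝓝[<] 0)) :
    Tendsto (fun k => f^[k] (lowerPar (s k, a k))) atTop (𝓝 (upperPar (0, x'))) ↔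
      Tendsto (fun k => transit (lowerMap f) chartShift k (s k) (a k)) atTop (𝓝 x') := by
  have hs0 : Tendsto s atTop (𝓝 0) := hs.mono_right nhdsWithin_le_nhds
  have hneg : ∀ᶠ k in atTop, s k < 0 := hs self_mem_nhdsWithin
  have he : (fun k => f^[k] (lowerPar (s k, a k))) =ᶠ[atTop]
      fun k => upperPar (s k, transit (lowerMap f) chartShift k (s k) (a k)) := by
    filter_upwards [hneg] with k hk
    rw [isFoliatedChart_lower.iterate_par hf, lowerPar_eq hk, transit]
  rw [tendsto_congr' he, isFoliatedChart_upper.tendsto_par_iff]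
  exact ⟨fun h => h.2, fun h => ⟨hs0, h⟩⟩

/-- The leaf of a k meets the lower half plane near Δ and, through the k-th iterate, the upper one
near Δ'. So it is eventually a curve, of negative parameter. -/
theorem exists_lower_coordinates (hf : ∀ p, Before p (f p)) {a b : ℕ → Plane} {x x' : ℝ}
    (hab : ∀ k, b k ∈ leafOf (a k)) (ha : Tendsto a atTop (𝓝 (lowerPar (0, x))))
    (ha' : Tendsto (fun k => f^[k] (a k)) atTop (𝓝 (upperPar (0, x')))) :
    ∃ s α β : ℕ → ℝ, Tendsto s atTop (𝓝[<] 0) ∧ Tendsto α atTop (𝓝 x) ∧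
      Tendsto (fun k => transit (lowerMap f) chartShift k (s k) (α k)) atTop (𝓝 x') ∧
      (∀ᶠ k in atTop, a k = lowerPar (s k, α k)) ∧ ∀ᶠ k in atTop, b k = lowerPar (s k, β k) := by
  obtain ⟨h1, h2, h3⟩ := isFoliatedChart_lower.tendsto_chart ha
  have hae : ∀ᶠ k in atTop, a k = lowerPar ((lowerChart (a k)).1, (lowerChart (a k)).2) :=
    h3.mono fun k hk => hk.symm
  have hs : Tendsto (fun k => (lowerChart (a k)).1) atTop (𝓝[<] 0) := by
    refine tendsto_nhdsWithin_iff.2 ⟨h1, ?_⟩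
    filter_upwards [hae, ha' (isFoliatedChart_upper.isOpen.mem_nhds (isFoliatedChart_upper.mem _))]
      with k hk hk'
    have hk'' : f^[k] (a k) ∈ upperHalf := hk'
    rw [hk, isFoliatedChart_lower.iterate_par hf, lowerPar_mem_upperHalf_iff] at hk''
    exact hk''
  refine ⟨_, fun k => (lowerChart (a k)).2, fun k => (lowerChart (b k)).2, hs, h2, ?_, hae, ?_⟩
  · refine (tendsto_iterate_lowerPar_iff hf hs).1 (ha'.congr' ?_)
    filter_upwards [hae] with k hk
    rw [← hk]
  · filter_upwards [hae] with k hk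
    have := hab k
    rw [hk, isFoliatedChart_lower.mem_leafOf] at this
    obtain ⟨y, hy⟩ := this
    rw [hy, lowerChart_lowerPar]

theorem Delta_eq (p : Plane) : p ∈ Delta ↔ ∃ x, p = lowerPar (0, x) := by
  simp only [lowerPar_zero]; rfl

theorem Delta'_eq (p : Plane) : p ∈ Delta' ↔ ∃ x, p = upperPar (0, x) := by
  simp only [upperPar_zero]
  exact ⟨fun ⟨t, ht⟩ => ⟨-t, by rw [neg_neg, ht]⟩, fun ⟨t, ht⟩ => ⟨-t, ht⟩⟩

theorem fourPoint_iff (hf : ∀ p, Before p (f p)) :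
    FourPoint f ↔ ChartFourPoint (lowerMap f) chartShift := by
  have hlow : ∀ {s b : ℕ → ℝ}, Tendsto s atTop (𝓝[<] 0) →
      ((∃ y ∈ Delta, Tendsto (fun k => lowerPar (s k, b k)) atTop (𝓝 y)) ↔
        ∃ y, Tendsto b atTop (𝓝 y)) := by
    intro s b hs
    have hs0 : Tendsto s atTop (𝓝 0) := hs.mono_right nhdsWithin_le_nhds
    constructor
    · rintro ⟨p, hp, h⟩
      obtain ⟨y, rfl⟩ := (Delta_eq p).1 hp
      exact ⟨y, (isFoliatedChart_lower.tendsto_par_iff.1 h).2⟩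
    · rintro ⟨y, h⟩
      exact ⟨_, (Delta_eq _).2 ⟨y, rfl⟩, isFoliatedChart_lower.tendsto_par_iff.2 ⟨hs0, h⟩⟩
  have hup : ∀ {s b : ℕ → ℝ}, Tendsto s atTop (𝓝[<] 0) →
      ((∃ y ∈ Delta', Tendsto (fun k => f^[k] (lowerPar (s k, b k))) atTop (𝓝 y)) ↔
        ∃ y, Tendsto (fun k => transit (lowerMap f) chartShift k (s k) (b k)) atTop (𝓝 y)) := by
    intro s b hs
    constructor
    · rintro ⟨p, hp, h⟩
      obtain ⟨y, rfl⟩ := (Delta'_eq p).1 hp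
      exact ⟨y, (tendsto_iterate_lowerPar_iff hf hs).1 h⟩
    · rintro ⟨y, h⟩
      exact ⟨_, (Delta'_eq _).2 ⟨y, rfl⟩, (tendsto_iterate_lowerPar_iff hf hs).2 h⟩
  constructor
  · intro h x x' s a b hs ha ha'
    rw [← hlow hs, ← hup hs]
    exact h _ ((Delta_eq _).2 ⟨x, rfl⟩) _ ((Delta'_eq _).2 ⟨x', rfl⟩)
      (fun k => lowerPar (s k, a k)) (fun k => lowerPar (s k, b k))
      (isFoliatedChart_lower.tendsto_par_iff.2 ⟨hs.mono_right nhdsWithin_le_nhds, ha⟩)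
      ((tendsto_iterate_lowerPar_iff hf hs).2 ha')
      fun k => isFoliatedChart_lower.mem_leafOf.2 ⟨_, rfl⟩
  · intro h p hp p' hp' a b ha ha' hab
    obtain ⟨x, rfl⟩ := (Delta_eq p).1 hp
    obtain ⟨x', rfl⟩ := (Delta'_eq p').1 hp'
    obtain ⟨s, α, β, hs, hα, hα', -, hbe⟩ := exists_lower_coordinates hf hab ha ha'
    have h1 := h x x' s α β hs hα hα'
    rw [← hlow hs, ← hup hs] at h1
    have e1 : ∀ y, Tendsto b atTop (𝓝 y) ↔
        Tendsto (fun k => lowerPar (s k, β k)) atTop (𝓝 y) := fun y => tendsto_congr' hbe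
    have e2 : ∀ y, Tendsto (fun k => f^[k] (b k)) atTop (𝓝 y) ↔
        Tendsto (fun k => f^[k] (lowerPar (s k, β k))) atTop (𝓝 y) := fun y =>
      tendsto_congr' (hbe.mono fun k hk => by simp only [hk])
    simp only [e1, e2]
    exact h1

theorem sim_iff (hf : ∀ p, Before p (f p)) {p q : Delta × Delta'} {x x' y y' : ℝ}
    (hx : (p.1 : Plane) = lowerPar (0, x)) (hx' : (p.2 : Plane) = upperPar (0, x'))
    (hy : (q.1 : Plane) = lowerPar (0, y)) (hy' : (q.2 : Plane) = upperPar (0, y')) :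
    Sim f p q ↔ ChartSim (lowerMap f) chartShift x x' y y' := by
  rw [Sim, hx, hx', hy, hy']
  constructor
  · rintro ⟨a, b, hab, ha, hb, ha', hb'⟩
    obtain ⟨s, α, β, hs, hα, hα', -, hbe⟩ := exists_lower_coordinates hf hab ha ha'
    refine ⟨s, α, β, hs, hα, ?_, hα', ?_⟩
    · exact (isFoliatedChart_lower.tendsto_par_iff.1 ((tendsto_congr' hbe).1 hb)).2
    · refine (tendsto_iterate_lowerPar_iff hf hs).1 (hb'.congr' ?_)
      filter_upwards [hbe] with k hk
      rw [hk]
  · rintro ⟨s, a, b, hs, ha, hb, ha', hb'⟩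
    have hs0 : Tendsto s atTop (𝓝 0) := hs.mono_right nhdsWithin_le_nhds
    exact ⟨fun k => lowerPar (s k, a k), fun k => lowerPar (s k, b k),
      fun k => isFoliatedChart_lower.mem_leafOf.2 ⟨_, rfl⟩,
      isFoliatedChart_lower.tendsto_par_iff.2 ⟨hs0, ha⟩,
      isFoliatedChart_lower.tendsto_par_iff.2 ⟨hs0, hb⟩,
      (tendsto_iterate_lowerPar_iff hf hs).2 ha', (tendsto_iterate_lowerPar_iff hf hs).2 hb'⟩

/-- One of the four implications suffices; it is the one that gives associativity. -/
theorem EightPoint.chart (hf : ∀ p, Before p (f p)) (h8 : EightPoint f)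
    (x₁ x₁' y₁ y₁' x₂ x₂' y₂ y₂' : ℝ) (hA : ChartSim (lowerMap f) chartShift x₁ x₁' y₁ y₁')
    (hC : ChartSim (lowerMap f) chartShift x₂ x₁' y₂ y₁')
    (hD : ChartSim (lowerMap f) chartShift x₂ x₂' y₂ y₂') :
    ChartSim (lowerMap f) chartShift x₁ x₂' y₁ y₂' := by
  have h := (h8 ⟨_, (Delta_eq _).2 ⟨x₁, rfl⟩⟩ ⟨_, (Delta_eq _).2 ⟨y₁, rfl⟩⟩
    ⟨_, (Delta_eq _).2 ⟨x₂, rfl⟩⟩ ⟨_, (Delta_eq _).2 ⟨y₂, rfl⟩⟩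
    ⟨_, (Delta'_eq _).2 ⟨x₁', rfl⟩⟩ ⟨_, (Delta'_eq _).2 ⟨y₁', rfl⟩⟩
    ⟨_, (Delta'_eq _).2 ⟨x₂', rfl⟩⟩ ⟨_, (Delta'_eq _).2 ⟨y₂', rfl⟩⟩).2.1
  rw [sim_iff hf rfl rfl rfl rfl, sim_iff hf rfl rfl rfl rfl, sim_iff hf rfl rfl rfl rfl,
    sim_iff hf rfl rfl rfl rfl] at h
  exact h ⟨hA, hC, hD⟩

theorem eightPoint_of_chartSim (hf : ∀ p, Before p (f p)) {T T' : ℝ → ℝ}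
    (h : ∀ x x' y y', ChartSim (lowerMap f) chartShift x x' y y' ↔ T y - T x = T' y' - T' x') :
    EightPoint f := by
  rintro ⟨x₁, hx₁⟩ ⟨y₁, hy₁⟩ ⟨x₂, hx₂⟩ ⟨y₂, hy₂⟩ ⟨x₁', hx₁'⟩ ⟨y₁', hy₁'⟩ ⟨x₂', hx₂'⟩ ⟨y₂', hy₂'⟩
  obtain ⟨x₁, rfl⟩ := (Delta_eq _).1 hx₁
  obtain ⟨y₁, rfl⟩ := (Delta_eq _).1 hy₁
  obtain ⟨x₂, rfl⟩ := (Delta_eq _).1 hx₂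
  obtain ⟨y₂, rfl⟩ := (Delta_eq _).1 hy₂
  obtain ⟨x₁', rfl⟩ := (Delta'_eq _).1 hx₁'
  obtain ⟨y₁', rfl⟩ := (Delta'_eq _).1 hy₁'
  obtain ⟨x₂', rfl⟩ := (Delta'_eq _).1 hx₂'
  obtain ⟨y₂', rfl⟩ := (Delta'_eq _).1 hy₂'
  intro A B C D
  have eA : A ↔ _ := (sim_iff hf rfl rfl rfl rfl).trans (h _ _ _ _)
  have eB : B ↔ _ := (sim_iff hf rfl rfl rfl rfl).trans (h _ _ _ _)
  have eC : C ↔ _ := (sim_iff hf rfl rfl rfl rfl).trans (h _ _ _ _)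
  have eD : D ↔ _ := (sim_iff hf rfl rfl rfl rfl).trans (h _ _ _ _)
  rw [eA, eB, eC, eD]
  refine ⟨?_, ?_, ?_, ?_⟩ <;> rintro ⟨h1, h2, h3⟩ <;> linarith

end Matching

/-! ### Time functions of a flow -/

section FlowToTime

variable {Φ : Flow ℝ Plane}

theorem IsReebFlow.before (hΦ : IsReebFlow Φ) {t : ℝ} (ht : 0 < t) (p : Plane) :
    Before p (Φ t p) := (hΦ t ht).before p

/-- T s x is the time needed to flow from the point of coordinate 0 to that of coordinate x on the
leaf s: the inverse of an orbit map. -/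
theorem IsReebFlow.exists_time (hΦ : IsReebFlow Φ) {par : ℝ × ℝ → Plane} {chart : Plane → ℝ × ℝ}
    {Ω : Set Plane} (h : IsFoliatedChart par chart Ω) :
    ∃ T : ℝ → ℝ → ℝ, Continuous (uncurry T) ∧ (∀ s, StrictMono (T s)) ∧ (∀ s, Surjective (T s)) ∧
      ∀ t s x x', Φ t (par (s, x)) = par (s, x') ↔ T s x' = T s x + t := by
  have hleaf : ∀ t s x, ∃ x', Φ t (par (s, x)) = par (s, x') := by
    intro t s x
    rcases lt_trichotomy t 0 with ht | rfl | ht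
    · have h1 := hΦ.before (neg_pos.2 ht) (Φ t (par (s, x)))
      rw [← Φ.map_add, neg_add_cancel, Φ.map_zero_apply] at h1
      obtain ⟨x', -, hx'⟩ := (h.after s x _).1 h1
      exact ⟨x', hx'⟩
    · exact ⟨x, Φ.map_zero_apply _⟩
    · obtain ⟨x', -, hx'⟩ := (h.before s x _).1 (hΦ.before ht _)
      exact ⟨x', hx'⟩
  choose P hP using hleaf
  have hPc : P = fun t s x => (chart (Φ t (par (s, x)))).2 := by
    funext t s x; rw [hP, h.chart_par]
  have hPadd : ∀ t u s x, P t s (P u s x) = P (t + u) s x := fun t u s x => by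
    have : par (s, P t s (P u s x)) = par (s, P (t + u) s x) := by
      rw [← hP, ← hP, ← hP, Φ.map_add]
    exact (Prod.mk.inj (h.injective this)).2
  have hPzero : ∀ s x, P 0 s x = x := fun s x => by
    have : par (s, P 0 s x) = par (s, x) := by rw [← hP, Φ.map_zero_apply]
    exact (Prod.mk.inj (h.injective this)).2
  have hPlt : ∀ t s x, 0 < t → x < P t s x := fun t s x ht => by
    have := hΦ.before ht (par (s, x))
    rwa [hP, h.before_par] at this
  have hpush : ∀ t, 0 < t → IsPushFamily (P t) := fun t ht => by
    have := h.isPushFamily (f := Φ.toHomeomorph t) fun p => hΦ.before ht p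
    rw [hPc]; exact this
  have hPit : ∀ (n : ℕ) s x, (P 1 s)^[n] x = P n s x := by
    intro n s x
    induction n with
    | zero => simp [hPzero]
    | succ n ih => rw [iterate_succ_apply', ih, hPadd, Nat.cast_succ, add_comm]
  have hQc : Continuous (uncurry fun s t => P t s 0) := by
    have h1 : Continuous fun z : ℝ × ℝ => Φ z.2 (par (z.1, 0)) :=
      Φ.continuous continuous_snd (h.cont.comp (continuous_fst.prodMk continuous_const))
    rw [hPc]
    exact continuous_snd.comp (h.chart_cont.comp_continuous h1 fun z => by
      rw [hP]; exact h.mem _)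
  have hQm : ∀ s, StrictMono fun t => P t s 0 := by
    intro s t u htu
    have := hPlt (u - t) s (P t s 0) (sub_pos.2 htu)
    rwa [hPadd, sub_add_cancel] at this
  have hQs : ∀ s y, ∃ t, P t s 0 = y := by
    intro s y
    have hp := hpush 1 one_pos
    have hc : Continuous fun t => P t s 0 := hQc.comp (continuous_const.prodMk continuous_id)
    obtain ⟨n, hn⟩ := exists_lt_iterate (hp.cont_apply s) (hp.lt s) 0 y
    obtain ⟨m, hm⟩ := exists_lt_iterate (hp.cont_apply s) (hp.lt s) y 0
    refine mem_range_of_exists_le_of_exists_ge hc ⟨-m, ?_⟩ ⟨n, by rw [← hPit]; exact hn.le⟩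
    have h1 : (P 1 s)^[m] (P (-m) s 0) < (P 1 s)^[m] y := by
      rwa [hPit m s (P (-m) s 0), hPadd, add_neg_cancel, hPzero]
    exact (((hp.mono s).iterate m).lt_iff_lt.1 h1).le
  choose T hT using hQs
  have hTm : ∀ s, StrictMono (T s) := fun s x y hxy => by
    rw [← (hQm s).lt_iff_lt]; simpa only [hT] using hxy
  refine ⟨T, continuous_uncurry_of_rightInverse hQc hQm hT, hTm,
    fun s t => ⟨P t s 0, (hQm s).injective (hT s _)⟩, fun t s x x' => ?_⟩
  have h1 : P t s x = P (T s x + t) s 0 := by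
    conv_lhs => rw [← hT s x]
    rw [hPadd, add_comm]
  have h2 : Φ t (par (s, x)) = par (s, x') ↔ P t s x = x' := by
    rw [hP]
    exact ⟨fun h' => (Prod.mk.inj (h.injective h')).2, fun h' => by rw [h']⟩
  rw [h2, h1]
  exact ⟨fun h' => (hQm s).injective ((hT s x').trans h'.symm), fun h' => by rw [← h', hT]⟩

theorem IsReebFlow.exists_isTime {f : Plane ≃ₜ Plane} (hf : ∀ p, Before p (f p))
    (hΦ : IsReebFlow Φ) (hΦf : IsTimeOne Φ f) :
    ∃ (T T' : ℝ → ℝ → ℝ) (d : ℝ → ℝ), IsTime T (lowerMap f) ∧ IsTime T' (upperMap f) ∧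
      (∀ s x, s < 0 → T s (x + chartShift s) = T' s x + d s) ∧
      (∀ t s x x', Φ t (lowerPar (s, x)) = lowerPar (s, x') ↔ T s x' = T s x + t) ∧
      ∀ t s x x', Φ t (upperPar (s, x)) = upperPar (s, x') ↔ T' s x' = T' s x + t := by
  obtain ⟨T, hTc, hTm, hTs, hT⟩ := hΦ.exists_time isFoliatedChart_lower
  obtain ⟨T', hTc', hTm', hTs', hT'⟩ := hΦ.exists_time isFoliatedChart_upper
  refine ⟨T, T', fun s => T s (chartShift s) - T' s 0, ⟨hTc, hTm, hTs, fun s x => ?_⟩,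
    ⟨hTc', hTm', hTs', fun s x => ?_⟩, fun s x hs => ?_, hT, hT'⟩
  · rw [← hT, hΦf, isFoliatedChart_lower.apply_par hf]
  · rw [← hT', hΦf, isFoliatedChart_upper.apply_par hf]
  · have h1 := (hT' (T' s x - T' s 0) s 0 x).2 (by ring)
    rw [upperPar_eq hs, upperPar_eq hs, hT, zero_add] at h1
    rw [h1]; ring

end FlowToTime

/-! ### Uniqueness on the nonseparated leaves -/

section Uniqueness

/-- In the coordinate α, increments of β over a step d equal a quantity read on the other line,
independent of the starting point. So β is additive up to a constant, hence affine by continuity,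
with slope 1 because F is a unit step for both. -/
theorem sub_eq_sub_of_matching {α α' β β' F : ℝ → ℝ} (hα : StrictMono α) (hαs : Surjective α)
    (hαs' : Surjective α') (hβ : Continuous β) (hαF : ∀ x, α (F x) = α x + 1)
    (hβF : ∀ x, β (F x) = β x + 1)
    (h : ∀ x x' y y', α y - α x = α' y' - α' x' → β y - β x = β' y' - β' x') (x y : ℝ) :
    β y - β x = α y - α x := by
  let e : ℝ ≃o ℝ := hα.orderIsoOfSurjective α hαs
  have he : ∀ u, α (e.symm u) = u := fun u => e.apply_symm_apply u
  have he' : ∀ u, e.symm (α u) = u := fun u => e.symm_apply_apply u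
  let G : ℝ → ℝ := fun u => β (e.symm u)
  have hGc : Continuous G := hβ.comp e.symm.continuous
  have hG : ∀ u v d, G (u + d) - G u = G (v + d) - G v := by
    intro u v d
    obtain ⟨x', hx'⟩ := hαs' 0
    obtain ⟨y', hy'⟩ := hαs' d
    rw [h (e.symm u) x' (e.symm (u + d)) y' (by rw [he, he, hx', hy']; ring),
      h (e.symm v) x' (e.symm (v + d)) y' (by rw [he, he, hx', hy']; ring)]
  let g : ℝ →+ ℝ :=
    { toFun := fun d => G d - G 0
      map_zero' := sub_self _
      map_add' := fun a b => by
        have := hG a 0 b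
        rw [zero_add] at this
        linarith }
  have hgc : Continuous g := hGc.sub continuous_const
  have hlin : ∀ d, g d = d * g 1 := fun d => by
    have := (g.toRealLinearMap hgc).map_smul d 1
    simpa using this
  have hg1 : g 1 = 1 := by
    have h1 := hG (α 0) 0 1
    have h2 : G (α 0 + 1) - G (α 0) = 1 := by
      simp only [G]
      rw [← hαF, he', he', hβF]; ring
    rw [h2, zero_add] at h1
    exact h1.symm
  have h3 : ∀ x, β x = α x + G 0 := fun x => by
    have h4 : G (α x) - G 0 = α x := by
      have := hlin (α x)
      rw [hg1, mul_one] at this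
      exact this
    have h5 : G (α x) = β x := by simp only [G, he']
    linarith
  rw [h3, h3]; ring

theorem flow_eq_on_nonseparated {f : Plane ≃ₜ Plane} (hf : ∀ p, Before p (f p))
    {Φ Ψ : Flow ℝ Plane} (hΦ : IsReebFlow Φ) (hΨ : IsReebFlow Ψ) (hΦf : IsTimeOne Φ f)
    (hΨf : IsTimeOne Ψ f) (t : ℝ) (p : Plane) (hp : p ∈ Delta ∪ Delta') : Φ t p = Ψ t p := by
  obtain ⟨T, T', d, hT, hT', hd, hΦT, hΦT'⟩ := hΦ.exists_isTime hf hΦf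
  obtain ⟨R, R', e, hR, hR', he, hΨR, hΨR'⟩ := hΨ.exists_isTime hf hΨf
  have hm := isReebModel hf
  have h1 := fun x x' y y' => (hm.chartSim_iff_of_time hT hT' hd x x' y y').symm.trans
    (hm.chartSim_iff_of_time hR hR' he x x' y y')
  rcases hp with hp | hp
  · obtain ⟨x, rfl⟩ := (Delta_eq p).1 hp
    obtain ⟨y, hy⟩ := hT.surj 0 (T 0 x + t)
    have h2 := sub_eq_sub_of_matching (hT.mono 0) (hT.surj 0) (hT'.surj 0)
      (hR.cont.comp (continuous_const.prodMk continuous_id)) (hT.step 0) (hR.step 0)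
      (fun x x' y y' => (h1 x x' y y').1) x y
    simp only [comp_apply, uncurry, id] at h2
    rw [(hΦT t 0 x y).2 hy, (hΨR t 0 x y).2 (by linarith)]
  · obtain ⟨x, rfl⟩ := (Delta'_eq p).1 hp
    obtain ⟨y, hy⟩ := hT'.surj 0 (T' 0 x + t)
    have h2 := sub_eq_sub_of_matching (hT'.mono 0) (hT'.surj 0) (hT.surj 0)
      (hR'.cont.comp (continuous_const.prodMk continuous_id)) (hT'.step 0) (hR'.step 0)
      (fun x x' y y' hh => ((h1 x' x y' y).1 hh.symm).symm) x y
    simp only [comp_apply, uncurry, id] at h2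
    rw [(hΦT' t 0 x y).2 hy, (hΨR' t 0 x y).2 (by linarith)]

end Uniqueness

/-! ### Building the flow from time functions -/

section TimeToFlow

/-- Running the flow back from time t to time 0 is the homotopy. -/
theorem orientationPreserving_flow (Φ : Flow ℝ Plane) (t : ℝ) :
    OrientationPreserving (Φ.toHomeomorph t) := by
  intro p
  have hcont : Continuous fun z : unitInterval × Punctured =>
      Φ ((1 - (z.1 : ℝ)) * t) (p + z.2.1) - Φ ((1 - (z.1 : ℝ)) * t) p := by
    have h1 : Continuous fun z : unitInterval × Punctured => (1 - (z.1 : ℝ)) * t :=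
      (continuous_const.sub (continuous_subtype_val.comp continuous_fst)).mul continuous_const
    exact (Φ.continuous h1 (continuous_const.add (continuous_subtype_val.comp continuous_snd))).sub
      (Φ.continuous h1 continuous_const)
  refine ⟨{ toFun := fun z => ⟨Φ ((1 - (z.1 : ℝ)) * t) (p + z.2.1) - Φ ((1 - (z.1 : ℝ)) * t) p,
              fun h => z.2.2 ?_⟩
            continuous_toFun := hcont.subtype_mk _
            map_zero_left := fun v => ?_
            map_one_left := fun v => ?_ }⟩
  · have h1 : p + z.2.1 = p := (Φ.toHomeomorph _).injective (sub_eq_zero.1 h)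
    simpa using h1
  · ext1; simp [centredAt]
  · ext1; simp

theorem isReebFlow_of_before (Φ : Flow ℝ Plane) (hΦ : ∀ t p, 0 < t → Before p (Φ t p)) :
    IsReebFlow Φ := by
  intro t ht
  refine ⟨⟨orientationPreserving_flow Φ t, fun p => (hΦ t p ht).ne⟩, fun L hL =>
    ⟨Set.Subset.antisymm ?_ fun q hq => ?_, fun x _ => hΦ t x ht⟩⟩
  · rintro _ ⟨p, hp, rfl⟩
    exact ((hΦ t p ht).mem_iff hL).1 hp
  · refine ⟨(Φ.toHomeomorph t).symm q, ?_, (Φ.toHomeomorph t).apply_symm_apply q⟩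
    have h1 := hΦ t ((Φ.toHomeomorph t).symm q) ht
    rw [← Φ.toHomeomorph_apply, (Φ.toHomeomorph t).apply_symm_apply] at h1
    exact (h1.mem_iff hL).2 hq

/-- In each chart the flow adds t to the time. The two definitions agree on the curves because the
constant d s cancels. -/
theorem flowable_of_time {f : Plane ≃ₜ Plane} (hf : ∀ p, Before p (f p)) {T T' : ℝ → ℝ → ℝ}
    {d : ℝ → ℝ} (hT : IsTime T (lowerMap f)) (hT' : IsTime T' (upperMap f))
    (hd : ∀ s x, s < 0 → T s (x + chartShift s) = T' s x + d s) : Flowable f := by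
  classical
  choose G hG using hT.surj
  choose G' hG' using hT'.surj
  have hGT : ∀ s x, G s (T s x) = x := fun s x => (hT.mono s).injective (hG _ _)
  have hGT' : ∀ s x, G' s (T' s x) = x := fun s x => (hT'.mono s).injective (hG' _ _)
  have hGc := continuous_uncurry_of_rightInverse hT.cont hT.mono hG
  have hGc' := continuous_uncurry_of_rightInverse hT'.cont hT'.mono hG'
  let low : ℝ → ℝ × ℝ → Plane := fun t z => lowerPar (z.1, G z.1 (T z.1 z.2 + t))
  let up : ℝ → ℝ × ℝ → Plane := fun t z => upperPar (z.1, G' z.1 (T' z.1 z.2 + t))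
  have hlowc : Continuous fun z : ℝ × (ℝ × ℝ) => low z.1 z.2 := by
    have h1 : Continuous fun z : ℝ × (ℝ × ℝ) => z.2.1 := continuous_fst.comp continuous_snd
    exact lowerPar_continuous.comp (h1.prodMk (hGc.comp
      (h1.prodMk ((hT.cont.comp continuous_snd).add continuous_fst))))
  have hupc : Continuous fun z : ℝ × (ℝ × ℝ) => up z.1 z.2 := by
    have h1 : Continuous fun z : ℝ × (ℝ × ℝ) => z.2.1 := continuous_fst.comp continuous_snd
    exact isFoliatedChart_upper.cont.comp (h1.prodMk (hGc'.comp
      (h1.prodMk ((hT'.cont.comp continuous_snd).add continuous_fst))))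
  let Φ : ℝ → Plane → Plane := fun t p =>
    if p ∈ lowerHalf then low t (lowerChart p) else up t (upperChart p)
  have hlow : ∀ t s x, Φ t (lowerPar (s, x)) = lowerPar (s, G s (T s x + t)) := fun t s x => by
    simp only [Φ, if_pos (isFoliatedChart_lower.mem (s, x)), lowerChart_lowerPar, low]
  have hup : ∀ t s x, Φ t (upperPar (s, x)) = upperPar (s, G' s (T' s x + t)) := fun t s x => by
    by_cases hmem : upperPar (s, x) ∈ lowerHalf
    · have hs : s < 0 := by
        have h3 : lowerPar (s, -x) ∈ upperHalf := by
          rw [← reflect_mem_lowerHalf]; exact hmem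
        exact (lowerPar_mem_upperHalf_iff _).1 h3
      rw [upperPar_eq hs, upperPar_eq hs, hlow]
      congr 2
      apply (hT.mono s).injective
      rw [hG, hd s _ hs, hd s _ hs, hG']
      ring
    · simp only [Φ, if_neg hmem, isFoliatedChart_upper.chart_par, up]
  have hcases : ∀ p : Plane, (∃ s x, p = lowerPar (s, x)) ∨ ∃ s x, p = upperPar (s, x) := by
    intro p
    rcases mem_lowerHalf_or_mem_upperHalf p with hp | hp
    · exact Or.inl ⟨_, _, (isFoliatedChart_lower.par_chart p hp).symm⟩
    · exact Or.inr ⟨_, _, (isFoliatedChart_upper.par_chart p hp).symm⟩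
  have hΦlow : ∀ t, ∀ p ∈ lowerHalf, Φ t p = low t (lowerChart p) := fun t p hp => if_pos hp
  have hΦup : ∀ t, ∀ p ∈ upperHalf, Φ t p = up t (upperChart p) := fun t p hp => by
    conv_lhs => rw [← isFoliatedChart_upper.par_chart p hp]
    exact hup t _ _
  have hcont : Continuous (uncurry Φ) := by
    rw [continuous_iff_continuousAt]
    rintro ⟨t, p⟩
    rcases mem_lowerHalf_or_mem_upperHalf p with hp | hp
    · have hnhds := isFoliatedChart_lower.isOpen.mem_nhds hp
      have h1 : ContinuousAt (fun z : ℝ × Plane => (z.1, lowerChart z.2)) (t, p) :=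
        continuous_fst.continuousAt.prodMk (ContinuousAt.comp (f := Prod.snd)
          (isFoliatedChart_lower.chart_cont.continuousAt hnhds) continuous_snd.continuousAt)
      have h2 := ContinuousAt.comp (f := fun z : ℝ × Plane => (z.1, lowerChart z.2))
        hlowc.continuousAt h1
      refine h2.congr ?_
      filter_upwards [continuous_snd.continuousAt.preimage_mem_nhds hnhds] with z hz
      exact (hΦlow z.1 z.2 hz).symm
    · have hnhds := isFoliatedChart_upper.isOpen.mem_nhds hp
      have h1 : ContinuousAt (fun z : ℝ × Plane => (z.1, upperChart z.2)) (t, p) :=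
        continuous_fst.continuousAt.prodMk (ContinuousAt.comp (f := Prod.snd)
          (isFoliatedChart_upper.chart_cont.continuousAt hnhds) continuous_snd.continuousAt)
      have h2 := ContinuousAt.comp (f := fun z : ℝ × Plane => (z.1, upperChart z.2))
        hupc.continuousAt h1
      refine h2.congr ?_
      filter_upwards [continuous_snd.continuousAt.preimage_mem_nhds hnhds] with z hz
      exact (hΦup z.1 z.2 hz).symm
  let F : Flow ℝ Plane :=
    { toFun := Φ
      cont' := hcont
      map_add' := fun t u p => by
        rcases hcases p with ⟨s, x, rfl⟩ | ⟨s, x, rfl⟩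
        · rw [hlow, hlow, hlow, hG, add_assoc, add_comm t u]
        · rw [hup, hup, hup, hG', add_assoc, add_comm t u]
      map_zero' := fun p => by
        rcases hcases p with ⟨s, x, rfl⟩ | ⟨s, x, rfl⟩
        · rw [hlow, add_zero, hGT]
        · rw [hup, add_zero, hGT'] }
  have hF : ∀ t p, F t p = Φ t p := fun _ _ => rfl
  refine ⟨F, isReebFlow_of_before F fun t p ht => ?_, fun p => ?_⟩
  · rw [hF]
    rcases hcases p with ⟨s, x, rfl⟩ | ⟨s, x, rfl⟩
    · rw [hlow, isFoliatedChart_lower.before_par, ← (hT.mono s).lt_iff_lt, hG]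
      linarith
    · rw [hup, isFoliatedChart_upper.before_par, ← (hT'.mono s).lt_iff_lt, hG']
      linarith
  · rw [hF]
    rcases hcases p with ⟨s, x, rfl⟩ | ⟨s, x, rfl⟩
    · rw [hlow, isFoliatedChart_lower.apply_par hf, ← hT.step, hGT]
    · rw [hup, isFoliatedChart_upper.apply_par hf, ← hT'.step, hGT']

end TimeToFlow

end Reeb

theorem theorem1 (f : Reeb.Plane ≃ₜ Reeb.Plane) (hf : Reeb.IsReebHomeo f) :
    (Reeb.Flowable f ↔ Reeb.FourPoint f ∧ Reeb.EightPoint f) ∧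
    ∀ Φ Ψ : Flow ℝ Reeb.Plane, Reeb.IsReebFlow Φ → Reeb.IsReebFlow Ψ →
      Reeb.IsTimeOne Φ f → Reeb.IsTimeOne Ψ f →
      ∀ t : ℝ, ∀ x ∈ Reeb.Delta ∪ Reeb.Delta', Φ t x = Ψ t x := by
  have hm := Reeb.isReebModel hf.before
  refine ⟨⟨?_, ?_⟩, fun Φ Ψ hΦ hΨ hΦf hΨf t x hx =>
    Reeb.flow_eq_on_nonseparated hf.before hΦ hΨ hΦf hΨf t x hx⟩
  · rintro ⟨Φ, hΦ, hΦf⟩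
    obtain ⟨T, T', d, hT, hT', hd, -, -⟩ := hΦ.exists_isTime hf.before hΦf
    exact ⟨(Reeb.fourPoint_iff hf.before).2 (hm.chartFourPoint_of_time hT hT' hd),
      Reeb.eightPoint_of_chartSim hf.before (hm.chartSim_iff_of_time hT hT' hd)⟩
  · rintro ⟨h4, h8⟩
    obtain ⟨T, T', d, hT, hT', hd⟩ :=
      hm.exists_time ((Reeb.fourPoint_iff hf.before).1 h4) (h8.chart hf.before)
    exact Reeb.flowable_of_time hf.before hT hT' hd
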